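/- A function $\varphi:(0,\infty)\to(0,\infty)$ is called non-degenerate quasi-concave if $\varphi$ is non-decreasing, $\varphi(t)/t$ is non-increasing, and $$\lim_{t\to0+}\varphi(t)=\lim_{t\to\infty}\frac{\varphi(t)}{t}=\lim_{t\to0+}\frac{t}{\varphi(t)}=\lim_{t\to\infty}\frac1{\varphi(t)}=0 .$$ A positive sequence $(t_k)_{k\in\mathbb Z}$ is a discretizing sequence for $\varphi$ if, for all $k\in\mathbb Z$, $t_{k+1}\ge 2t_k$, $\varphi(t_{k+1})\ge 2\varphi(t_k)$ and $\frac{\varphi(t_{k+1})}{t_{k+1}}\le\frac12\,\frac{\varphi(t_k)}{t_k}$, and $\mathbb Z$ is a disjoint union $\mathbb Z_1\cup\mathbb Z_2$ with $\varphi(t_{k+1})\le2\varphi(t_k)$ for $k\in\mathbb Z_1$ and $\frac{\varphi(t_k)}{t_k}\le2\,\frac{\varphi(t_{k+1})}{t_{k+1}}$ for $k\in\mathbb Z_2$; every non-degenerate quasi-concave function has one. For a compatible couple $\overline X=(X_0,X_1)$ of Banach spaces let $K(t,x;\overline X)=\inf\{\|x_0\|_{X_0}+t\|x_1\|_{X_1}: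 x=x_0+x_1,\ x_i\in X_i\}$ be Peetre's K-functional, and for $1\le p\le\infty$ let $\overline X_{\varphi,p}=(X_0,X_1)_{\varphi,p}$ be the space of all $x\in X_0+X_1$ with $$\|x\|_{\varphi,p}=\Bigl(\sum_{k\in\mathbb Z}\Bigl(\frac{K(t_k,x;\overline X)}{\varphi(t_k)}\Bigr)^p\Bigr)^{1/p}<\infty$$ (the supremum over $k$ if $p=\infty$), where $(t_k)$ is a discretizing sequence for $\varphi$. **Theorem.** Let $\varphi_0,\varphi_1,\varphi$ be non-degenerate quasi-concave functions on $(0,\infty)$ and let $p\in[1,\infty]$. Put $\varphi(\varphi_0,\varphi_1)(t)=\varphi_0(t)\,\varphi\bigl(\varphi_1(t)/\varphi_0(t)\bigr)$. Then, for every compatible couple $\overline X$ of Banach spaces, $$(\overline X_{\varphi_0,p},\overline X_{\varphi_1,p})_{\varphi,p}=\overline X_{\varphi(\varphi_0,\varphi_1),p},$$ that is, the two sides are the same subspace of $X_0+X_1$ and their norms are equivalent. This holds whichever discretizing sequences for $\varphi_0$, $\varphi_1$, $\varphi$ and $\varphi(\varphi_0,\varphi_1)$ are used to form the four spaces, with constants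 of equivalence that do not depend on $\overline X$. -/

import Mathlib

open Set Filter Topology
open scoped ENNReal NNReal

namespace RealInterpolation

/-! ### Quasi-concave functions and discretizing sequences -/

/-- Positive non-degenerate quasi-concave functions on `(0, ∞)`. Only the values on `(0, ∞)`
are ever used. -/
structure IsNondegQuasiConcave (φ : ℝ → ℝ) : Prop where
  pos : ∀ t, 0 < t → 0 < φ t
  mono : MonotoneOn φ (Ioi 0)
  anti : AntitoneOn (fun t => φ t / t) (Ioi 0)
  tendsto_zero : Tendsto φ (𝓝[>] 0) (𝓝 0)
  tendsto_div_atTop : Tendsto (fun t => φ t / t) atTop (𝓝 0)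
  tendsto_div_zero : Tendsto (fun t => t / φ t) (𝓝[>] 0) (𝓝 0)
  tendsto_inv_atTop : Tendsto (fun t => 1 / φ t) atTop (𝓝 0)

/-- A sequence of positive numbers with `inf_k a (k+1) / a k ≥ 2`. -/
def StronglyIncreasing (a : ℤ → ℝ) : Prop :=
  (∀ k, 0 < a k) ∧ ∀ k, 2 ≤ a (k + 1) / a k

/-- A sequence of positive numbers with `sup_k a (k+1) / a k ≤ 1 / 2`. -/
def StronglyDecreasing (a : ℤ → ℝ) : Prop :=
  (∀ k, 0 < a k) ∧ ∀ k, a (k + 1) / a k ≤ 1 / 2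

/-- `t` is a discretizing sequence for `φ`. -/
structure IsDiscretizing (φ : ℝ → ℝ) (t : ℤ → ℝ) : Prop where
  strongIncr : StronglyIncreasing t
  strongIncr_comp : StronglyIncreasing (fun k => φ (t k))
  strongDecr_div : StronglyDecreasing (fun k => φ (t k) / t k)
  decomposition : ∃ Z₁ Z₂ : Set ℤ, Z₁ ∪ Z₂ = univ ∧ Z₁ ∩ Z₂ = ∅ ∧
    (∀ k ∈ Z₁, φ (t (k + 1)) ≤ 2 * φ (t k)) ∧
    (∀ k ∈ Z₂, φ (t k) / t k ≤ 2 * (φ (t (k + 1)) / t (k + 1)))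

/-- The function `φ(φ₀, φ₁)(t) = φ₀(t) φ(φ₁(t) / φ₀(t))`. -/
noncomputable def compose (φ φ₀ φ₁ : ℝ → ℝ) : ℝ → ℝ :=
  fun t => φ₀ t * φ (φ₁ t / φ₀ t)

/-! ### Banach couples and the real method

A normed space `X` contained in a vector space `A` is represented by its extended norm
`A → [0, ∞]`, which is the norm on `X` and `∞` outside `X`; so the space itself is the set of
points of finite norm. -/

/-- A compatible couple of Banach spaces: `X₀` and `X₁` are continuously and injectively
mapped into a common Hausdorff topological vector space `A`. -/
structure BanachCouple (𝕜 : Type*) [RCLike 𝕜] (X₀ X₁ A : Type*)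
    [NormedAddCommGroup X₀] [NormedSpace 𝕜 X₀] [CompleteSpace X₀]
    [NormedAddCommGroup X₁] [NormedSpace 𝕜 X₁] [CompleteSpace X₁]
    [AddCommGroup A] [Module 𝕜 A] [TopologicalSpace A] [IsTopologicalAddGroup A]
    [ContinuousSMul 𝕜 A] [T2Space A] where
  incl₀ : X₀ →L[𝕜] A
  incl₁ : X₁ →L[𝕜] A
  injective₀ : Function.Injective incl₀
  injective₁ : Function.Injective incl₁

/-- The extended norm on `A` of the normed space `X`, embedded by the injective map `j`:
it is `‖y‖` at `j y` and `∞` outside the range of `j`. -/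
noncomputable def imageNorm {X A : Type*} [NormedAddCommGroup X] (j : X → A) (x : A) : ℝ≥0∞ :=
  ⨅ (y : X) (_ : j y = x), ‖y‖ₑ

/-- The space on which an extended norm is finite. -/
def space {A : Type*} (N : A → ℝ≥0∞) : Set A := {x | N x < ∞}

/-- Peetre's K-functional of the couple of the spaces with extended norms `N₀`, `N₁`
(equal to `∞` outside the sum of the two spaces). -/
noncomputable def K {A : Type*} [AddCommGroup A] (N₀ N₁ : A → ℝ≥0∞) (t : ℝ) (x : A) : ℝ≥0∞ :=
  ⨅ (x₀ : A) (x₁ : A) (_ : x₀ + x₁ = x), N₀ x₀ + ENNReal.ofReal t * N₁ x₁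

/-- The (extended) norm of `ℓ_p(ℤ)`, `1 ≤ p ≤ ∞`, of a sequence with values in `[0, ∞]`. -/
noncomputable def lpNorm (p : ℝ≥0∞) (a : ℤ → ℝ≥0∞) : ℝ≥0∞ :=
  if p = ∞ then ⨆ k, a k else (∑' k, a k ^ p.toReal) ^ (1 / p.toReal)

/-- The extended norm of the real interpolation space `(X₀, X₁)_{φ,p}`, formed with the
sequence `t`: the `ℓ_p` norm of `K(t_k, x) / φ(t_k)`. -/
noncomputable def interpNorm {A : Type*} [AddCommGroup A] (φ : ℝ → ℝ) (t : ℤ → ℝ) (p : ℝ≥0∞)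
    (N₀ N₁ : A → ℝ≥0∞) (x : A) : ℝ≥0∞ :=
  lpNorm p (fun k => K N₀ N₁ (t k) x / ENNReal.ofReal (φ (t k)))

/-- The extended norm of `X_{φ,p}` for a Banach couple `X`. -/
noncomputable def BanachCouple.interp {𝕜 : Type*} [RCLike 𝕜] {X₀ X₁ A : Type*}
    [NormedAddCommGroup X₀] [NormedSpace 𝕜 X₀] [CompleteSpace X₀]
    [NormedAddCommGroup X₁] [NormedSpace 𝕜 X₁] [CompleteSpace X₁]
    [AddCommGroup A] [Module 𝕜 A] [TopologicalSpace A] [IsTopologicalAddGroup A]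
    [ContinuousSMul 𝕜 A] [T2Space A] (X : BanachCouple 𝕜 X₀ X₁ A)
    (φ : ℝ → ℝ) (t : ℤ → ℝ) (p : ℝ≥0∞) : A → ℝ≥0∞ :=
  interpNorm φ t p (imageNorm X.incl₀) (imageNorm X.incl₁)

/-! ### Discretizing sequences exist, and `φ(φ₀, φ₁)` is again non-degenerate -/

theorem IsNondegQuasiConcave.continuousOn {φ : ℝ → ℝ} (h : IsNondegQuasiConcave φ) :
    ContinuousOn φ (Ioi 0) := by
  intro a ha
  have ha' : (0 : ℝ) < a := ha
  apply ContinuousAt.continuousWithinAt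
  have hlow : Tendsto (fun s => φ a * min 1 (s / a)) (𝓝 a) (𝓝 (φ a)) := by
    have : ContinuousAt (fun s : ℝ => φ a * min 1 (s / a)) a := by fun_prop
    simpa [ContinuousAt, ha'.ne'] using this
  have hup : Tendsto (fun s => φ a * max 1 (s / a)) (𝓝 a) (𝓝 (φ a)) := by
    have : ContinuousAt (fun s : ℝ => φ a * max 1 (s / a)) a := by fun_prop
    simpa [ContinuousAt, ha'.ne'] using this
  have hpa := h.pos a ha'
  refine tendsto_of_tendsto_of_tendsto_of_le_of_le' hlow hup ?_ ?_
  · filter_upwards [lt_mem_nhds ha'] with s hs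
    rcases le_total s a with hsa | hsa
    · have := h.anti (show s ∈ Ioi 0 from hs) ha hsa
      simp only at this
      rw [div_le_div_iff₀ ha' hs] at this
      calc φ a * min 1 (s / a) ≤ φ a * (s / a) := by gcongr; exact min_le_right _ _
        _ ≤ φ s := by rw [← mul_div_assoc, div_le_iff₀ ha']; exact this
    · calc φ a * min 1 (s / a) ≤ φ a * 1 := by gcongr; exact min_le_left _ _
        _ ≤ φ s := by rw [mul_one]; exact h.mono ha hs hsa
  · filter_upwards [lt_mem_nhds ha'] with s hs
    rcases le_total s a with hsa | hsa
    · calc φ s ≤ φ a * 1 := by rw [mul_one]; exact h.mono hs ha hsa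
        _ ≤ _ := by gcongr; exact le_max_left _ _
    · have := h.anti ha (show s ∈ Ioi 0 from hs) hsa
      simp only at this
      rw [div_le_div_iff₀ hs ha'] at this
      calc φ s ≤ φ a * (s / a) := by rw [← mul_div_assoc, le_div_iff₀ ha']; exact this
        _ ≤ _ := by gcongr; exact le_max_right _ _

/-- The relation between two consecutive terms of the sequence constructed below. -/
def Step (φ : ℝ → ℝ) (a b : ℝ) : Prop :=
  2 * φ a ≤ φ b ∧ 2 * (a / φ a) ≤ b / φ b ∧ (φ b = 2 * φ a ∨ b / φ b = 2 * (a / φ a))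

theorem IsNondegQuasiConcave.tendsto_atTop {φ : ℝ → ℝ} (h : IsNondegQuasiConcave φ) :
    Tendsto φ atTop atTop := by
  have h1 : Tendsto (fun t => 1 / φ t) atTop (𝓝[>] 0) := by
    refine tendsto_nhdsWithin_iff.2 ⟨h.tendsto_inv_atTop, ?_⟩
    filter_upwards [eventually_gt_atTop 0] with t ht
    exact one_div_pos.2 (h.pos t ht)
  refine h1.inv_tendsto_nhdsGT_zero.congr fun t => ?_
  simp

theorem IsNondegQuasiConcave.tendsto_atTop' {φ : ℝ → ℝ} (h : IsNondegQuasiConcave φ) :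
    Tendsto (fun t => t / φ t) atTop atTop := by
  have h1 : Tendsto (fun t => φ t / t) atTop (𝓝[>] 0) := by
    refine tendsto_nhdsWithin_iff.2 ⟨h.tendsto_div_atTop, ?_⟩
    filter_upwards [eventually_gt_atTop 0] with t ht
    exact div_pos (h.pos t ht) ht
  have := h1.inv_tendsto_nhdsGT_zero
  refine this.congr fun t => ?_
  simp

theorem IsNondegQuasiConcave.exists_up {φ : ℝ → ℝ} (h : IsNondegQuasiConcave φ) {a : ℝ}
    (ha : 0 < a) : ∃ b, 0 < b ∧ Step φ a b := by
  have hpa := h.pos a ha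
  have hqa : 0 < a / φ a := div_pos ha hpa
  obtain ⟨c, hc1, hc2, hc3⟩ := ((h.tendsto_atTop.eventually_ge_atTop (2 * φ a)).and
    ((h.tendsto_atTop'.eventually_ge_atTop (2 * (a / φ a))).and (eventually_ge_atTop a))).exists
  have hsub : Icc a c ⊆ Ioi 0 := fun x hx => lt_of_lt_of_le ha hx.1
  have hcont : ContinuousOn (fun s => min (φ s / φ a) ((s / φ s) / (a / φ a))) (Icc a c) := by
    have h1 := h.continuousOn.mono hsub
    refine ContinuousOn.inf (h1.div_const _) (ContinuousOn.div_const ?_ _)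
    exact continuousOn_id.div h1 fun x hx => (h.pos x (hsub hx)).ne'
  have hmem : (2 : ℝ) ∈ Icc (min (φ a / φ a) ((a / φ a) / (a / φ a)))
      (min (φ c / φ a) ((c / φ c) / (a / φ a))) := by
    rw [div_self hpa.ne', div_self hqa.ne']
    exact ⟨by norm_num, le_min ((le_div_iff₀ hpa).2 hc1) ((le_div_iff₀ hqa).2 hc2)⟩
  obtain ⟨b, hb, hb2⟩ := intermediate_value_Icc hc3 hcont hmem
  simp only at hb2
  refine ⟨b, hsub hb, ?_, ?_, ?_⟩
  · rw [← le_div_iff₀ hpa, ← hb2]; exact min_le_left _ _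
  · rw [← le_div_iff₀ hqa, ← hb2]; exact min_le_right _ _
  · rcases min_choice (φ b / φ a) ((b / φ b) / (a / φ a)) with hm | hm
    · left; rw [hm] at hb2; exact (div_eq_iff hpa.ne').1 hb2
    · right; rw [hm] at hb2; exact (div_eq_iff hqa.ne').1 hb2

theorem IsNondegQuasiConcave.exists_down {φ : ℝ → ℝ} (h : IsNondegQuasiConcave φ) {b : ℝ}
    (hb : 0 < b) : ∃ a, 0 < a ∧ Step φ a b := by
  have hpb := h.pos b hb
  have hqb : 0 < b / φ b := div_pos hb hpb
  have e1 : ∀ᶠ s in 𝓝[>] (0 : ℝ), φ s ≤ φ b / 2 :=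
    (h.tendsto_zero.eventually_lt_const (half_pos hpb)).mono fun _ => le_of_lt
  have e2 : ∀ᶠ s in 𝓝[>] (0 : ℝ), s / φ s ≤ (b / φ b) / 2 :=
    (h.tendsto_div_zero.eventually_lt_const (half_pos hqb)).mono fun _ => le_of_lt
  have e3 : ∀ᶠ s in 𝓝[>] (0 : ℝ), s ∈ Ioo 0 b := Ioo_mem_nhdsGT hb
  obtain ⟨c, hc1, hc2, hc0, hc4'⟩ := (e1.and (e2.and e3)).exists
  have hc4 : c ≤ b := le_of_lt hc4'
  have hsub : Icc c b ⊆ Ioi 0 := fun x hx => lt_of_lt_of_le hc0 hx.1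
  have hcont : ContinuousOn (fun s => max (φ s / φ b) ((s / φ s) / (b / φ b))) (Icc c b) := by
    have h1 := h.continuousOn.mono hsub
    refine ContinuousOn.sup (h1.div_const _) (ContinuousOn.div_const ?_ _)
    exact continuousOn_id.div h1 fun x hx => (h.pos x (hsub hx)).ne'
  have hmem : (1 / 2 : ℝ) ∈ Icc (max (φ c / φ b) ((c / φ c) / (b / φ b)))
      (max (φ b / φ b) ((b / φ b) / (b / φ b))) := by
    rw [div_self hpb.ne', div_self hqb.ne']
    refine ⟨max_le ((div_le_iff₀ hpb).2 ?_) ((div_le_iff₀ hqb).2 ?_), by norm_num⟩ <;> linarith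
  obtain ⟨a, ha, ha2⟩ := intermediate_value_Icc hc4 hcont hmem
  simp only at ha2
  refine ⟨a, hsub ha, ?_, ?_, ?_⟩
  · have : φ a / φ b ≤ 1 / 2 := by rw [← ha2]; exact le_max_left _ _
    rw [div_le_iff₀ hpb] at this; linarith
  · have : (a / φ a) / (b / φ b) ≤ 1 / 2 := by rw [← ha2]; exact le_max_right _ _
    rw [div_le_iff₀ hqb] at this; linarith
  · rcases max_choice (φ a / φ b) ((a / φ a) / (b / φ b)) with hm | hm
    · left; rw [hm, div_eq_iff hpb.ne'] at ha2; linarith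
    · right; rw [hm, div_eq_iff hqb.ne'] at ha2; linarith

/-- Every non-degenerate quasi-concave function has a discretizing sequence. -/
theorem IsNondegQuasiConcave.exists_isDiscretizing {φ : ℝ → ℝ} (h : IsNondegQuasiConcave φ) :
    ∃ t, IsDiscretizing φ t := by
  have hu : ∀ a : {a : ℝ // 0 < a}, ∃ b : {b : ℝ // 0 < b}, Step φ a b := fun a => by
    obtain ⟨b, hb, hs⟩ := h.exists_up a.2
    exact ⟨⟨b, hb⟩, hs⟩
  have hd : ∀ b : {b : ℝ // 0 < b}, ∃ a : {a : ℝ // 0 < a}, Step φ a b := fun b => by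
    obtain ⟨a, ha, hs⟩ := h.exists_down b.2
    exact ⟨⟨a, ha⟩, hs⟩
  choose u hu using hu
  choose d hd using hd
  let e : {a : ℝ // 0 < a} := ⟨1, one_pos⟩
  let T : ℤ → {a : ℝ // 0 < a} := fun k => match k with
    | Int.ofNat n => u^[n] e
    | Int.negSucc n => d^[n + 1] e
  have hT : ∀ k, Step φ (T k) (T (k + 1)) := by
    intro k
    match k with
    | Int.ofNat n =>
      have : T (Int.ofNat n + 1) = u (u^[n] e) := by
        rw [← Function.iterate_succ_apply' u n e]; rfl
      rw [this]; exact hu _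
    | Int.negSucc 0 => exact hd _
    | Int.negSucc (n + 1) =>
      have h1 : T (Int.negSucc (n + 1)) = d (d^[n + 1] e) := by
        rw [← Function.iterate_succ_apply' d (n + 1) e]
      have h2 : T (Int.negSucc (n + 1) + 1) = d^[n + 1] e := rfl
      rw [h1, h2]; exact hd _
  have hp : ∀ k, 0 < φ (T k) := fun k => h.pos _ (T k).2
  have hq : ∀ k, 0 < (T k : ℝ) / φ (T k) := fun k => div_pos (T k).2 (hp k)
  have hinv : ∀ k, φ (T k) / (T k : ℝ) = ((T k : ℝ) / φ (T k))⁻¹ := fun k => by rw [inv_div]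
  refine ⟨fun k => T k, ⟨fun k => (T k).2, fun k => ?_⟩, ⟨hp, fun k => ?_⟩,
    ⟨fun k => div_pos (hp k) (T k).2, fun k => ?_⟩,
    {k | φ (T (k + 1)) ≤ 2 * φ (T k)}, {k | φ (T (k + 1)) ≤ 2 * φ (T k)}ᶜ,
    union_compl_self _, inter_compl_self _, fun k hk => hk, fun k hk => ?_⟩
  · obtain ⟨h1, h2, -⟩ := hT k
    have e1 : ∀ j, (T j : ℝ) = φ (T j) * (T j / φ (T j)) := fun j => by
      field_simp [(hp j).ne']
    rw [le_div_iff₀ (T k).2]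
    calc 2 * (T k : ℝ) ≤ 4 * (T k : ℝ) := by linarith [(T k).2]
      _ = (2 * φ (T k)) * (2 * ((T k : ℝ) / φ (T k))) := by rw [e1 k]; field_simp [(hp k).ne']; ring
      _ ≤ φ (T (k + 1)) * (T (k + 1) / φ (T (k + 1))) := by
        have := hq k; have := hp k; have := hp (k + 1); gcongr
      _ = _ := (e1 (k + 1)).symm
  · exact (le_div_iff₀ (hp k)).2 (hT k).1
  · have := (hT k).2.1
    simp only [hinv]
    rw [inv_div_inv, div_le_iff₀ (hq (k + 1))]; linarith
  · obtain ⟨h1, h2, h3⟩ := hT k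
    rcases h3 with h3 | h3
    · exact absurd h3.le hk
    · simp only [hinv, h3, mul_inv]
      linarith

theorem IsNondegQuasiConcave.perspective_mono {φ : ℝ → ℝ} (h : IsNondegQuasiConcave φ)
    {x x' y y' : ℝ} (hx : 0 < x) (hy : 0 < y) (hxx : x ≤ x') (hyy : y ≤ y') :
    x * φ (y / x) ≤ x' * φ (y' / x') := by
  have hx' : 0 < x' := hx.trans_le hxx
  have h1 : φ (y / x) / (y / x) ≤ φ (y / x') / (y / x') :=
    h.anti (show (0 : ℝ) < y / x' by positivity) (show (0 : ℝ) < y / x by positivity)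
      (by gcongr)
  have h2 : φ (y / x') ≤ φ (y' / x') :=
    h.mono (show (0 : ℝ) < y / x' by positivity)
      (show (0 : ℝ) < y' / x' from div_pos (hy.trans_le hyy) hx') (by gcongr)
  calc x * φ (y / x) = y * (φ (y / x) / (y / x)) := by field_simp
    _ ≤ y * (φ (y / x') / (y / x')) := by gcongr
    _ = x' * φ (y / x') := by field_simp
    _ ≤ _ := by gcongr

/-- `φ(φ₀, φ₁)` is a positive non-degenerate quasi-concave function. -/
theorem IsNondegQuasiConcave.compose {φ φ₀ φ₁ : ℝ → ℝ} (h : IsNondegQuasiConcave φ)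
    (h₀ : IsNondegQuasiConcave φ₀) (h₁ : IsNondegQuasiConcave φ₁) :
    IsNondegQuasiConcave (compose φ φ₀ φ₁) := by
  have hc : 0 < φ 1 := h.pos 1 one_pos
  have hup : ∀ {x y : ℝ}, 0 < x → 0 < y → x * φ (y / x) ≤ (x + y) * φ 1 := fun {x y} hx hy => by
    have := h.perspective_mono hx hy (show x ≤ x + y by linarith) (show y ≤ x + y by linarith)
    rwa [div_self (by positivity)] at this
  have hlo : ∀ {x y : ℝ}, 0 < x → 0 < y → 1 / (x * φ (y / x)) ≤ (1 / x + 1 / y) / φ 1 :=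
    fun {x y} hx hy => by
      have hm : 0 < min x y := lt_min hx hy
      have := h.perspective_mono hm hm (min_le_left x y) (min_le_right x y)
      rw [div_self hm.ne'] at this
      calc 1 / (x * φ (y / x)) ≤ 1 / (min x y * φ 1) := by gcongr
        _ = (1 / min x y) / φ 1 := by field_simp
        _ ≤ _ := by
          gcongr
          have := one_div_pos.2 hx
          have := one_div_pos.2 hy
          rcases min_choice x y with e | e <;> rw [e] <;> linarith
  have hpos : ∀ t, 0 < t → 0 < RealInterpolation.compose φ φ₀ φ₁ t := fun t ht =>
    mul_pos (h₀.pos t ht) (h.pos _ (div_pos (h₁.pos t ht) (h₀.pos t ht)))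
  have hdiv : ∀ t, 0 < t → RealInterpolation.compose φ φ₀ φ₁ t / t =
      φ₀ t / t * φ ((φ₁ t / t) / (φ₀ t / t)) := fun t ht => by
    rw [div_div_div_cancel_right₀ ht.ne', RealInterpolation.compose]; ring
  refine ⟨hpos, ?_, ?_, ?_, ?_, ?_, ?_⟩
  · intro s hs t ht hst
    exact h.perspective_mono (h₀.pos s hs) (h₁.pos s hs) (h₀.mono hs ht hst) (h₁.mono hs ht hst)
  · intro s hs t ht hst
    simp only
    rw [hdiv s hs, hdiv t ht]
    exact h.perspective_mono (div_pos (h₀.pos t ht) ht) (div_pos (h₁.pos t ht) ht)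
      (h₀.anti hs ht hst) (h₁.anti hs ht hst)
  · have hl := (h₀.tendsto_zero.add h₁.tendsto_zero).mul_const (φ 1)
    simp only [add_zero, zero_mul] at hl
    refine tendsto_of_tendsto_of_tendsto_of_le_of_le' tendsto_const_nhds hl ?_ ?_
    · filter_upwards [self_mem_nhdsWithin] with t ht using (hpos t ht).le
    · filter_upwards [self_mem_nhdsWithin] with t ht using hup (h₀.pos t ht) (h₁.pos t ht)
  · have hl := (h₀.tendsto_div_atTop.add h₁.tendsto_div_atTop).mul_const (φ 1)
    simp only [add_zero, zero_mul] at hl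
    refine tendsto_of_tendsto_of_tendsto_of_le_of_le' tendsto_const_nhds hl ?_ ?_
    · filter_upwards [eventually_gt_atTop 0] with t ht using (div_pos (hpos t ht) ht).le
    · filter_upwards [eventually_gt_atTop 0] with t ht
      rw [hdiv t ht]
      exact hup (div_pos (h₀.pos t ht) ht) (div_pos (h₁.pos t ht) ht)
  · have hl := (h₀.tendsto_div_zero.add h₁.tendsto_div_zero).div_const (φ 1)
    simp only [add_zero, zero_div] at hl
    refine tendsto_of_tendsto_of_tendsto_of_le_of_le' tendsto_const_nhds hl ?_ ?_
    · filter_upwards [self_mem_nhdsWithin] with t ht using (div_pos ht (hpos t ht)).le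
    · filter_upwards [self_mem_nhdsWithin] with t ht
      have := hlo (div_pos (h₀.pos t ht) ht) (div_pos (h₁.pos t ht) ht)
      rw [← hdiv t ht] at this
      simpa only [one_div_div] using this
  · have hl := (h₀.tendsto_inv_atTop.add h₁.tendsto_inv_atTop).div_const (φ 1)
    simp only [add_zero, zero_div] at hl
    refine tendsto_of_tendsto_of_tendsto_of_le_of_le' tendsto_const_nhds hl ?_ ?_
    · filter_upwards [eventually_gt_atTop 0] with t ht using (one_div_pos.2 (hpos t ht)).le
    · filter_upwards [eventually_gt_atTop 0] with t ht using hlo (h₀.pos t ht) (h₁.pos t ht)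

end RealInterpolation

/-!
Write `ψ = φ(φ₀, φ₁)`. The K-functional of `x` is quasi-concave, hence controlled by its values
at a discretizing sequence `(t'_k)` of `ψ`.

If `x` lies in the space with parameter `ψ`, differences of nearly optimal decompositions of `x`
at the points `t'_k` exhibit it as a sum of atoms `U_k` with
`K(s, U_k) ≲ min(1, s / t'_k) K(t'_k, x)`. Splitting the series according to whether
`φ₁(t'_k) / φ₀(t'_k)` is below or above `t_m` gives, for each `m`, a decomposition of `x` that is
good for the outer K-functional at `t_m`. Conversely, on the block of those `k` with
`t_m ≤ φ₁(t'_k) / φ₀(t'_k) < t_{m+1}`, one decomposition of `x` that is nearly optimal for the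
outer K-functional, taken at one of the two endpoints, bounds all the `K(t'_k, x) / ψ(t'_k)`.
In both directions the `ℓ_p` bounds are Schur tests, for kernels whose rows and columns are
dominated by geometric series.
-/

namespace RealInterpolation

/-! ### The extended `ℓ_p` norm -/

/-- The extended norm of `ℓ_p(ι)`; for `ι = ℤ` it is `lpNorm`. Families indexed by `ℤ × ℤ` arise
from iterated norms. -/
noncomputable def lpENorm {ι : Type*} (p : ℝ≥0∞) (a : ι → ℝ≥0∞) : ℝ≥0∞ :=
  if p = ∞ then ⨆ k, a k else (∑' k, a k ^ p.toReal) ^ (1 / p.toReal)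

section lpENorm

variable {ι κ : Type*} {p : ℝ≥0∞}

theorem lpENorm_top (a : ι → ℝ≥0∞) : lpENorm ∞ a = ⨆ k, a k := if_pos rfl

theorem lpENorm_of_ne_top (hp : p ≠ ∞) (a : ι → ℝ≥0∞) :
    lpENorm p a = (∑' k, a k ^ p.toReal) ^ (1 / p.toReal) := if_neg hp

theorem lpENorm_rpow (hp₀ : p ≠ 0) (hp : p ≠ ∞) (a : ι → ℝ≥0∞) :
    lpENorm p a ^ p.toReal = ∑' k, a k ^ p.toReal := by
  rw [lpENorm_of_ne_top hp, ← ENNReal.rpow_mul,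
    one_div_mul_cancel (ENNReal.toReal_pos hp₀ hp).ne', ENNReal.rpow_one]

theorem lpENorm_le_iff (hp₀ : p ≠ 0) (hp : p ≠ ∞) {a : ι → ℝ≥0∞} {B : ℝ≥0∞} :
    lpENorm p a ≤ B ↔ ∑' k, a k ^ p.toReal ≤ B ^ p.toReal := by
  rw [← lpENorm_rpow hp₀ hp, ENNReal.rpow_le_rpow_iff (ENNReal.toReal_pos hp₀ hp)]

theorem lpENorm_mono {a b : ι → ℝ≥0∞} (h : ∀ k, a k ≤ b k) : lpENorm p a ≤ lpENorm p b := by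
  rcases eq_or_ne p ∞ with rfl | hp
  · simpa only [lpENorm_top] using iSup_mono h
  · simp only [lpENorm_of_ne_top hp]
    gcongr
    exact h _

theorem le_lpENorm (hp₀ : p ≠ 0) (a : ι → ℝ≥0∞) (k : ι) : a k ≤ lpENorm p a := by
  rcases eq_or_ne p ∞ with rfl | hp
  · exact (le_iSup a k).trans_eq (lpENorm_top a).symm
  · rw [← ENNReal.rpow_le_rpow_iff (ENNReal.toReal_pos hp₀ hp), lpENorm_rpow hp₀ hp]
    exact ENNReal.le_tsum (f := fun k => a k ^ p.toReal) k

theorem lpENorm_const_mul (hp₀ : p ≠ 0) (c : ℝ≥0∞) (a : ι → ℝ≥0∞) :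
    lpENorm p (fun k => c * a k) = c * lpENorm p a := by
  rcases eq_or_ne p ∞ with rfl | hp
  · simp only [lpENorm_top, ENNReal.mul_iSup]
  · have hq := ENNReal.toReal_pos hp₀ hp
    simp only [lpENorm_of_ne_top hp, ENNReal.mul_rpow_of_nonneg _ _ hq.le, ENNReal.tsum_mul_left]
    rw [ENNReal.mul_rpow_of_nonneg _ _ (by positivity), ← ENNReal.rpow_mul,
      mul_one_div_cancel hq.ne', ENNReal.rpow_one]

theorem lpENorm_prod (hp₀ : p ≠ 0) (a : ι → κ → ℝ≥0∞) :
    lpENorm p (fun q : ι × κ => a q.1 q.2) = lpENorm p fun i => lpENorm p (a i) := by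
  rcases eq_or_ne p ∞ with rfl | hp
  · simp only [lpENorm_top, iSup_prod]
  · rw [lpENorm_of_ne_top hp, lpENorm_of_ne_top hp]
    simp only [lpENorm_rpow hp₀ hp]
    rw [ENNReal.tsum_prod (f := fun i j => a i j ^ p.toReal)]

theorem lpENorm_comp_equiv (e : κ ≃ ι) (a : ι → ℝ≥0∞) :
    lpENorm p (fun k => a (e k)) = lpENorm p a := by
  rcases eq_or_ne p ∞ with rfl | hp
  · simpa only [lpENorm_top] using e.iSup_comp
  · simp only [lpENorm_of_ne_top hp, e.tsum_eq fun k => a k ^ p.toReal]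

theorem lpENorm_fibers (hp₀ : p ≠ 0) (n : ι → κ) (a : ι → ℝ≥0∞) :
    lpENorm p (fun m => lpENorm p ((n ⁻¹' {m}).indicator a)) = lpENorm p a := by
  classical
  rcases eq_or_ne p ∞ with rfl | hp
  · simp only [lpENorm_top]
    rw [iSup_comm]
    refine iSup_congr fun k => le_antisymm (iSup_le fun m => indicator_le_self _ _ k) ?_
    exact le_iSup_of_le (n k) (by simp)
  · have hfiber : ∀ m k, (n ⁻¹' {m}).indicator a k ^ p.toReal =
        if m = n k then a k ^ p.toReal else 0 := fun m k => by
      simp [indicator_apply, eq_comm, apply_ite (· ^ p.toReal), ENNReal.toReal_pos hp₀ hp]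
    rw [lpENorm_of_ne_top hp, lpENorm_of_ne_top hp]
    simp only [lpENorm_rpow hp₀ hp, hfiber]
    rw [ENNReal.tsum_comm]
    simp only [tsum_ite_eq]

theorem one_le_toReal (hp₁ : 1 ≤ p) (hp : p ≠ ∞) : 1 ≤ p.toReal := by
  simpa using ENNReal.toReal_mono hp hp₁

theorem lpENorm_add_le (hp₁ : 1 ≤ p) (a b : ι → ℝ≥0∞) :
    lpENorm p (fun k => a k + b k) ≤ lpENorm p a + lpENorm p b := by
  rcases eq_or_ne p ∞ with rfl | hp
  · simpa only [lpENorm_top] using iSup_le fun k => add_le_add (le_iSup a k) (le_iSup b k)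
  · let _ : MeasurableSpace ι := ⊤
    simpa only [lpENorm_of_ne_top hp, MeasureTheory.lintegral_count, Pi.add_apply] using
      ENNReal.lintegral_Lp_add_le (μ := .count) (Measurable.of_discrete (f := a)).aemeasurable
        (Measurable.of_discrete (f := b)).aemeasurable (one_le_toReal hp₁ hp)

theorem tsum_mul_rpow_le {q : ℝ} (hq : 1 ≤ q) (c a : κ → ℝ≥0∞) :
    (∑' j, c j * a j) ^ q ≤ (∑' j, c j) ^ (q - 1) * ∑' j, c j * a j ^ q := by
  have hq₀ : 0 < q := by linarith
  rw [← ENNReal.le_rpow_inv_iff hq₀, ENNReal.tsum_eq_iSup_sum]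
  refine iSup_le fun s => (ENNReal.inner_le_weight_mul_Lp_of_nonneg s hq c a).trans ?_
  have hexp : (q - 1) * q⁻¹ = 1 - q⁻¹ := by field_simp
  have hexp₀ : 0 ≤ 1 - q⁻¹ := sub_nonneg.2 (inv_le_one_of_one_le₀ hq)
  rw [ENNReal.mul_rpow_of_nonneg _ _ (by positivity), ← ENNReal.rpow_mul, hexp]
  gcongr <;> exact ENNReal.sum_le_tsum s

theorem lpENorm_schur (hp₁ : 1 ≤ p) {c : ι → κ → ℝ≥0∞} {D : ℝ≥0∞} (hrow : ∀ i, ∑' j, c i j ≤ D)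
    (hcol : ∀ j, ∑' i, c i j ≤ D) (a : κ → ℝ≥0∞) :
    lpENorm p (fun i => ∑' j, c i j * a j) ≤ D * lpENorm p a := by
  rcases eq_or_ne p ∞ with rfl | hp
  · simp only [lpENorm_top]
    refine iSup_le fun i => ?_
    calc ∑' j, c i j * a j ≤ ∑' j, c i j * ⨆ k, a k := by
          gcongr with j
          exact le_iSup a j
      _ = (∑' j, c i j) * ⨆ k, a k := ENNReal.tsum_mul_right
      _ ≤ D * ⨆ k, a k := by gcongr; exact hrow i
  · have hp₀ : p ≠ 0 := (zero_lt_one.trans_le hp₁).ne'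
    have hq := one_le_toReal hp₁ hp
    rw [lpENorm_le_iff hp₀ hp, ENNReal.mul_rpow_of_nonneg _ _ ENNReal.toReal_nonneg,
      lpENorm_rpow hp₀ hp]
    calc ∑' i, (∑' j, c i j * a j) ^ p.toReal
        ≤ ∑' i, D ^ (p.toReal - 1) * ∑' j, c i j * a j ^ p.toReal := by
          gcongr with i
          refine (tsum_mul_rpow_le hq (c i) a).trans ?_
          gcongr
          exact hrow i
      _ = D ^ (p.toReal - 1) * ∑' j, (∑' i, c i j) * a j ^ p.toReal := by
          rw [ENNReal.tsum_mul_left, ENNReal.tsum_comm]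
          simp only [ENNReal.tsum_mul_right]
      _ ≤ D ^ (p.toReal - 1) * ∑' j, D * a j ^ p.toReal := by
          gcongr with j
          exact hcol j
      _ = D ^ p.toReal * ∑' j, a j ^ p.toReal := by
          have hD : D ^ (p.toReal - 1) * D = D ^ p.toReal := by
            simpa using (ENNReal.rpow_add_of_nonneg (x := D) _ 1 (sub_nonneg.2 hq) zero_le_one).symm
          rw [ENNReal.tsum_mul_left, ← mul_assoc, hD]

end lpENorm

/-- The sum of the terms of a sequence at a point and at its two neighbours: the error made when
an argument is located only up to one step of a discretizing sequence. -/
noncomputable def neighbourSum (a : ℤ → ℝ≥0∞) (k : ℤ) : ℝ≥0∞ := a (k - 1) + a k + a (k + 1)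

theorem pred_le_neighbourSum (a : ℤ → ℝ≥0∞) (k : ℤ) : a (k - 1) ≤ neighbourSum a k := by
  rw [neighbourSum, add_assoc]
  exact le_self_add

theorem self_le_neighbourSum (a : ℤ → ℝ≥0∞) (k : ℤ) : a k ≤ neighbourSum a k := by
  rw [neighbourSum, add_right_comm]
  exact le_add_self

theorem succ_le_neighbourSum (a : ℤ → ℝ≥0∞) (k : ℤ) : a (k + 1) ≤ neighbourSum a k :=
  le_add_self

theorem neighbourSum_le {a : ℤ → ℝ≥0∞} {R : ℝ≥0∞} (h : ∀ k, a k ≤ R) (k : ℤ) :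
    neighbourSum a k ≤ 3 * R :=
  (add_le_add (add_le_add (h _) (h _)) (h _)).trans_eq (by ring)

theorem lpENorm_neighbourSum_le {p : ℝ≥0∞} (hp₁ : 1 ≤ p) (a : ℤ → ℝ≥0∞) :
    lpENorm p (neighbourSum a) ≤ 3 * lpENorm p a := by
  have hshift : ∀ j : ℤ, lpENorm p (fun k => a (k + j)) = lpENorm p a := fun j =>
    lpENorm_comp_equiv (Equiv.addRight j) a
  calc lpENorm p (neighbourSum a)
      ≤ lpENorm p (fun k => a (k - 1)) + lpENorm p a + lpENorm p (fun k => a (k + 1)) :=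
        (lpENorm_add_le hp₁ _ _).trans (add_le_add_left (lpENorm_add_le hp₁ _ _) _)
    _ = 3 * lpENorm p a := by
        simp only [sub_eq_add_neg, hshift]
        ring

/-! ### Geometric sums and quasi-concave functions -/

theorem tsum_indicator_le_of_doubling {a : ℤ → ℝ≥0∞} (ha : ∀ k, 2 * a k ≤ a (k + 1)) {G : Set ℤ}
    {B : ℝ≥0∞} (hG : ∀ k ∈ G, a k ≤ B) : ∑' k, G.indicator a k ≤ 2 * B := by
  classical
  have hmono : Monotone a := monotone_int_of_le_succ fun k =>
    (le_mul_of_one_le_left zero_le one_le_two).trans (ha k)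
  have hlt : ∀ k n, k < n → a k ≤ a n / 2 := fun k n hkn => by
    rw [ENNReal.le_div_iff_mul_le (by simp) (by simp), mul_comm]
    exact (ha k).trans (hmono hkn)
  have hfin : ∀ F : Finset ℤ, ∀ B : ℝ≥0∞, (∀ k ∈ F, a k ≤ B) → ∑ k ∈ F, a k ≤ 2 * B := by
    intro F
    induction F using Finset.induction_on_max with
    | empty => simp
    | insert m F hF ih =>
      intro B hB
      have hm : m ∉ F := fun h => lt_irrefl _ (hF m h)
      have hmB : a m ≤ B := hB m (Finset.mem_insert_self _ _)
      calc ∑ k ∈ insert m F, a k = a m + ∑ k ∈ F, a k := Finset.sum_insert hm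
        _ ≤ a m + 2 * (a m / 2) := by
            gcongr
            exact ih _ fun k hk => hlt k m (hF k hk)
        _ = 2 * a m := by rw [ENNReal.mul_div_cancel (by simp) (by simp), two_mul]
        _ ≤ 2 * B := by gcongr
  rw [ENNReal.tsum_eq_iSup_sum]
  refine iSup_le fun F => ?_
  rw [Finset.sum_indicator_eq_sum_filter]
  exact hfin _ B fun k hk => hG k (Finset.mem_filter.1 hk).2

theorem tsum_indicator_le_of_halving {a : ℤ → ℝ≥0∞} (ha : ∀ k, 2 * a (k + 1) ≤ a k) {G : Set ℤ}
    {B : ℝ≥0∞} (hG : ∀ k ∈ G, a k ≤ B) : ∑' k, G.indicator a k ≤ 2 * B := by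
  rw [← (Equiv.neg ℤ).tsum_eq]
  exact tsum_indicator_le_of_doubling (a := fun k => a (-k)) (G := (fun k => -k) ⁻¹' G)
    (fun k => by simpa [add_comm] using ha (-(k + 1))) (fun k hk => hG _ hk)

theorem two_mul_ofReal_le {x y : ℝ} (h : 2 * x ≤ y) :
    2 * ENNReal.ofReal x ≤ ENNReal.ofReal y := by
  rw [← ENNReal.ofReal_ofNat 2, ← ENNReal.ofReal_mul zero_le_two]
  exact ENNReal.ofReal_le_ofReal h

theorem StronglyIncreasing.two_mul_le {a : ℤ → ℝ} (h : StronglyIncreasing a) (k : ℤ) :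
    2 * a k ≤ a (k + 1) :=
  (le_div_iff₀ (h.1 k)).1 (h.2 k)

theorem StronglyDecreasing.two_mul_le {a : ℤ → ℝ} (h : StronglyDecreasing a) (k : ℤ) :
    2 * a (k + 1) ≤ a k := by
  have := (div_le_iff₀ (h.1 k)).1 (h.2 k)
  linarith

theorem StronglyIncreasing.tsum_indicator_le {a : ℤ → ℝ} (h : StronglyIncreasing a) {G : Set ℤ}
    {B : ℝ} (hG : ∀ k ∈ G, a k ≤ B) :
    ∑' k, G.indicator (fun k => ENNReal.ofReal (a k)) k ≤ ENNReal.ofReal (2 * B) := by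
  rw [ENNReal.ofReal_mul zero_le_two, ENNReal.ofReal_ofNat]
  exact tsum_indicator_le_of_doubling (fun k => two_mul_ofReal_le (h.two_mul_le k))
    fun k hk => ENNReal.ofReal_le_ofReal (hG k hk)

theorem StronglyDecreasing.tsum_indicator_le {a : ℤ → ℝ} (h : StronglyDecreasing a) {G : Set ℤ}
    {B : ℝ} (hG : ∀ k ∈ G, a k ≤ B) :
    ∑' k, G.indicator (fun k => ENNReal.ofReal (a k)) k ≤ ENNReal.ofReal (2 * B) := by
  rw [ENNReal.ofReal_mul zero_le_two, ENNReal.ofReal_ofNat]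
  exact tsum_indicator_le_of_halving (fun k => two_mul_ofReal_le (h.two_mul_le k))
    fun k hk => ENNReal.ofReal_le_ofReal (hG k hk)

theorem StronglyIncreasing.inv {a : ℤ → ℝ} (h : StronglyIncreasing a) :
    StronglyDecreasing fun k => (a k)⁻¹ :=
  ⟨fun k => inv_pos.2 (h.1 k), fun k => by
    rw [inv_div_inv, div_le_iff₀ (h.1 _)]
    linarith [h.two_mul_le k]⟩

theorem StronglyDecreasing.inv {a : ℤ → ℝ} (h : StronglyDecreasing a) :
    StronglyIncreasing fun k => (a k)⁻¹ :=
  ⟨fun k => inv_pos.2 (h.1 k), fun k => by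
    rw [inv_div_inv, le_div_iff₀ (h.1 _)]
    exact h.two_mul_le k⟩

theorem StronglyIncreasing.comp_neg {a : ℤ → ℝ} (h : StronglyIncreasing a) :
    StronglyDecreasing fun k => a (-k) :=
  ⟨fun k => h.1 _, fun k => by
    have := h.two_mul_le (-(k + 1))
    rw [neg_add, neg_add_cancel_right] at this
    rw [div_le_iff₀ (h.1 _)]
    simp only [neg_add]
    linarith⟩

theorem StronglyIncreasing.monotone {a : ℤ → ℝ} (h : StronglyIncreasing a) : Monotone a :=
  monotone_int_of_le_succ fun k => by linarith [h.two_mul_le k, h.1 k]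

theorem StronglyIncreasing.tendsto_atTop {a : ℤ → ℝ} (h : StronglyIncreasing a) :
    Tendsto (fun n : ℕ => a n) atTop atTop := by
  have hpow : ∀ n : ℕ, 2 ^ n * a 0 ≤ a n := fun n => by
    induction n with
    | zero => simp
    | succ n ih =>
      have := h.two_mul_le n
      push_cast
      rw [pow_succ]
      linarith
  exact tendsto_atTop_mono hpow
    ((tendsto_pow_atTop_atTop_of_one_lt one_lt_two).atTop_mul_const (h.1 0))

theorem StronglyIncreasing.tendsto_neg {a : ℤ → ℝ} (h : StronglyIncreasing a) :
    Tendsto (fun n : ℕ => a (-n)) atTop (𝓝 0) := by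
  simpa only [Pi.inv_def, inv_inv] using h.comp_neg.inv.tendsto_atTop.inv_tendsto_atTop

theorem StronglyIncreasing.exists_mem_Ico {a : ℤ → ℝ} (h : StronglyIncreasing a) {r : ℝ}
    (hr : 0 < r) : ∃ m, r ∈ Ico (a m) (a (m + 1)) := by
  obtain ⟨n, hn⟩ := (h.tendsto_atTop.eventually_gt_atTop r).exists
  obtain ⟨l, hl⟩ := (h.tendsto_neg.eventually_lt_const hr).exists
  have hbdd : ∀ z, a z ≤ r → z ≤ n := fun z hz =>
    (h.monotone.reflect_lt (hz.trans_lt hn)).le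
  obtain ⟨m, hm, hmax⟩ := Int.exists_greatest_of_bdd (P := fun m => a m ≤ r) ⟨n, hbdd⟩ ⟨-l, hl.le⟩
  exact ⟨m, hm, lt_of_not_ge fun hge => absurd (hmax _ hge) (by lia)⟩

/-- Positive quasi-concave functions on `(0, ∞)`, possibly degenerate. -/
structure IsQuasiConcave (f : ℝ → ℝ) : Prop where
  pos : ∀ t, 0 < t → 0 < f t
  mono : MonotoneOn f (Ioi 0)
  anti : AntitoneOn (fun t => f t / t) (Ioi 0)

theorem IsNondegQuasiConcave.isQuasiConcave {f : ℝ → ℝ} (h : IsNondegQuasiConcave f) :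
    IsQuasiConcave f := ⟨h.pos, h.mono, h.anti⟩

theorem IsQuasiConcave.dual {f : ℝ → ℝ} (h : IsQuasiConcave f) :
    IsQuasiConcave fun t => t / f t := by
  refine ⟨fun t ht => div_pos ht (h.pos t ht), fun s hs t ht hst => ?_, fun s hs t ht hst => ?_⟩
  · simpa only [inv_div] using inv_anti₀ (div_pos (h.pos t ht) ht) (h.anti hs ht hst)
  · have hcancel : ∀ {r : ℝ}, r ∈ Ioi 0 → r / f r / r = (f r)⁻¹ := fun hr => by
      rw [div_right_comm, div_self (ne_of_gt hr), one_div]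
    simp only [hcancel hs, hcancel ht]
    exact inv_anti₀ (h.pos s hs) (h.mono hs ht hst)

/-- The growth conditions relating a discretizing sequence `v` of a function `φ` to its values
`w k = φ (v k)`, freed from `φ`. -/
structure IsScale (v w : ℤ → ℝ) : Prop where
  strongIncr : StronglyIncreasing w
  strongDecr_div : StronglyDecreasing fun k => w k / v k

theorem IsDiscretizing.isScale {φ : ℝ → ℝ} {t : ℤ → ℝ} (h : IsDiscretizing φ t) :
    IsScale t fun k => φ (t k) := ⟨h.strongIncr_comp, h.strongDecr_div⟩

namespace IsScale

variable {v w : ℤ → ℝ} (h : IsScale v w)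
include h

theorem pos (k : ℤ) : 0 < v k :=
  (div_pos_iff_of_pos_left (h.strongIncr.1 k)).1 (h.strongDecr_div.1 k)

theorem dual : IsScale v fun k => v k / w k where
  strongIncr := by simpa only [inv_div] using h.strongDecr_div.inv
  strongDecr_div := by
    have hcancel : ∀ k, v k / w k / v k = (w k)⁻¹ := fun k => by
      rw [div_right_comm, div_self (h.pos k).ne', one_div]
    simpa only [hcancel] using h.strongIncr.inv

theorem tsum_atoms_le {f : ℝ → ℝ} (hf : IsQuasiConcave f) {G : Set ℤ} {M : ℝ} (hM : 0 ≤ M)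
    (hG : ∀ k ∈ G, w k ≤ M * f (v k)) {s : ℝ} (hs : 0 < s) :
    ∑' k, G.indicator (fun k => ENNReal.ofReal (w k * min 1 (s / v k))) k ≤
      ENNReal.ofReal (4 * (M * f s)) := by
  have hw := fun k => (h.strongIncr.1 k).le
  have hfs := hf.pos s hs
  have hlow : ∑' k, (G ∩ {k | v k ≤ s}).indicator (fun k => ENNReal.ofReal (w k)) k ≤
      ENNReal.ofReal (2 * (M * f s)) :=
    h.strongIncr.tsum_indicator_le fun k hk => (hG k hk.1).trans
      (mul_le_mul_of_nonneg_left (hf.mono (h.pos k) hs hk.2) hM)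
  have hhigh : ∑' k, (G ∩ {k | s < v k}).indicator (fun k => ENNReal.ofReal (w k / v k)) k ≤
      ENNReal.ofReal (2 * (M * (f s / s))) :=
    h.strongDecr_div.tsum_indicator_le fun k hk => by
      calc w k / v k ≤ M * f (v k) / v k := div_le_div_of_nonneg_right (hG k hk.1) (h.pos k).le
        _ = M * (f (v k) / v k) := mul_div_assoc ..
        _ ≤ _ := mul_le_mul_of_nonneg_left (hf.anti hs (h.pos k) (le_of_lt hk.2)) hM
  have hsplit : ∀ k, G.indicator (fun k => ENNReal.ofReal (w k * min 1 (s / v k))) k ≤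
      (G ∩ {k | v k ≤ s}).indicator (fun k => ENNReal.ofReal (w k)) k + ENNReal.ofReal s *
        (G ∩ {k | s < v k}).indicator (fun k => ENNReal.ofReal (w k / v k)) k := fun k => by
    by_cases hk : k ∈ G
    · rcases le_or_gt (v k) s with hks | hks
      · simpa [hk, hks, hks.not_gt] using ENNReal.ofReal_le_ofReal
          (mul_le_of_le_one_right (hw k) (min_le_left 1 (s / v k)))
      · simp only [indicator, hk, hks, hks.not_ge, ← ENNReal.ofReal_mul hs.le, mem_inter_iff,
          mem_ofPred_eq, and_true, and_false, if_true, if_false, zero_add, mul_div_left_comm s]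
        gcongr
        exacts [hw k, min_le_right _ _]
    · simp [hk]
  calc _ ≤ _ := ENNReal.tsum_le_tsum hsplit
    _ ≤ ENNReal.ofReal (2 * (M * f s)) +
          ENNReal.ofReal s * ENNReal.ofReal (2 * (M * (f s / s))) := by
        rw [ENNReal.tsum_add, ENNReal.tsum_mul_left]
        gcongr
    _ = ENNReal.ofReal (4 * (M * f s)) := by
        rw [← ENNReal.ofReal_mul hs.le, ← ENNReal.ofReal_add (by positivity) (by positivity)]
        congr 1
        field_simp
        ring

theorem tsum_dual_atoms_le {f : ℝ → ℝ} (hf : IsQuasiConcave f) {G : Set ℤ} {M : ℝ} (hM : 0 ≤ M)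
    (hG : ∀ k ∈ G, f (v k) ≤ M * w k) {s : ℝ} (hs : 0 < s) :
    ∑' k, G.indicator (fun k => ENNReal.ofReal (min 1 (v k / s) / w k)) k ≤
      ENNReal.ofReal (4 * (M / f s)) := by
  have hGdual : ∀ k ∈ G, v k / w k ≤ M * (v k / f (v k)) := fun k hk => by
    have hv := h.pos k
    rw [← mul_div_assoc, div_le_div_iff₀ (h.strongIncr.1 k) (hf.pos _ hv)]
    nlinarith [hG k hk]
  have hatom : ∀ k, min 1 (v k / s) / w k = s⁻¹ * (v k / w k * min 1 (s / v k)) := fun k => by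
    have hv := h.pos k
    have hmin : v k * min 1 (s / v k) = s * min 1 (v k / s) := by
      rw [mul_min_of_nonneg _ _ hv.le, mul_min_of_nonneg _ _ hs.le, mul_div_cancel₀ _ hv.ne',
        mul_div_cancel₀ _ hs.ne', min_comm, mul_one, mul_one]
    rw [div_mul_eq_mul_div, hmin]
    field_simp
  calc ∑' k, G.indicator (fun k => ENNReal.ofReal (min 1 (v k / s) / w k)) k
      = ENNReal.ofReal s⁻¹ *
          ∑' k, G.indicator (fun k => ENNReal.ofReal (v k / w k * min 1 (s / v k))) k := by
        simp only [hatom, ENNReal.ofReal_mul (inv_pos.2 hs).le, indicator_const_mul,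
          ENNReal.tsum_mul_left]
    _ ≤ ENNReal.ofReal s⁻¹ * ENNReal.ofReal (4 * (M * (s / f s))) := by
        gcongr
        exact h.dual.tsum_atoms_le hf.dual hM hGdual hs
    _ = ENNReal.ofReal (4 * (M / f s)) := by
        rw [← ENNReal.ofReal_mul (by positivity)]
        congr 1
        field_simp

end IsScale

theorem IsDiscretizing.tsum_atoms_le {φ : ℝ → ℝ} {t : ℤ → ℝ} (h : IsDiscretizing φ t)
    (hφ : IsQuasiConcave φ) {s : ℝ} (hs : 0 < s) :
    ∑' k, ENNReal.ofReal (φ (t k) * min 1 (s / t k)) ≤ ENNReal.ofReal (4 * φ s) := by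
  simpa using h.isScale.tsum_atoms_le hφ (G := univ) zero_le_one (fun _ _ => (one_mul _).ge) hs

theorem IsDiscretizing.tsum_dual_atoms_le {φ : ℝ → ℝ} {t : ℤ → ℝ} (h : IsDiscretizing φ t)
    (hφ : IsQuasiConcave φ) {s : ℝ} (hs : 0 < s) :
    ∑' k, ENNReal.ofReal (min 1 (t k / s) / φ (t k)) ≤ ENNReal.ofReal (4 / φ s) := by
  simpa only [indicator_univ, mul_one_div] using
    h.isScale.tsum_dual_atoms_le hφ (G := univ) zero_le_one (fun _ _ => (one_mul _).ge) hs

theorem IsDiscretizing.exists_endpoint_le {φ : ℝ → ℝ} {t : ℤ → ℝ} (ht : IsDiscretizing φ t)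
    (hφ : IsQuasiConcave φ) (m : ℤ) : ∃ j, (j = m ∨ j = m + 1) ∧ ∀ r ∈ Icc (t m) (t (m + 1)),
      φ (t j) ≤ 2 * φ r ∧ φ (t j) / t j ≤ 2 * (φ r / r) := by
  have hpos := ht.strongIncr.1
  obtain ⟨Z₁, Z₂, hcover, -, h₁, h₂⟩ := ht.decomposition
  rcases hcover.ge (mem_univ m) with hm | hm
  · refine ⟨m + 1, .inr rfl, fun r hr => ?_⟩
    have hr₀ : 0 < r := (hpos m).trans_le hr.1
    have := hφ.mono (hpos m) hr₀ hr.1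
    have := hφ.anti hr₀ (hpos (m + 1)) hr.2
    have := div_pos (hφ.pos r hr₀) hr₀
    exact ⟨(h₁ m hm).trans (by linarith), by dsimp only at *; linarith⟩
  · refine ⟨m, .inl rfl, fun r hr => ?_⟩
    have hr₀ : 0 < r := (hpos m).trans_le hr.1
    have := hφ.mono (hpos m) hr₀ hr.1
    have := hφ.anti hr₀ (hpos (m + 1)) hr.2
    have := hφ.pos r hr₀
    exact ⟨by linarith, (h₂ m hm).trans (by dsimp only at *; linarith)⟩

/-! ### The K-functional -/

section KFunctional

variable {A : Type*} [AddCommGroup A] {N₀ N₁ : A → ℝ≥0∞} {s t : ℝ} {x : A}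

theorem K_add_le (N₀ N₁ : A → ℝ≥0∞) (t : ℝ) (x₀ x₁ : A) :
    K N₀ N₁ t (x₀ + x₁) ≤ N₀ x₀ + ENNReal.ofReal t * N₁ x₁ :=
  iInf_le_of_le x₀ (iInf_le_of_le x₁ (iInf_le_of_le rfl le_rfl))

theorem le_K {B : ℝ≥0∞} (h : ∀ x₀ x₁, x₀ + x₁ = x → B ≤ N₀ x₀ + ENNReal.ofReal t * N₁ x₁) :
    B ≤ K N₀ N₁ t x :=
  le_iInf fun x₀ => le_iInf fun x₁ => le_iInf fun hx => h x₀ x₁ hx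

theorem le_mul_K {B c : ℝ≥0∞} (hc₀ : c ≠ 0) (hc : c ≠ ∞)
    (h : ∀ x₀ x₁, x₀ + x₁ = x → B ≤ c * (N₀ x₀ + ENNReal.ofReal t * N₁ x₁)) :
    B ≤ c * K N₀ N₁ t x := by
  rw [mul_comm, ← ENNReal.div_le_iff_le_mul (.inl hc₀) (.inl hc)]
  exact le_K fun x₀ x₁ hx => ENNReal.div_le_of_le_mul' (h x₀ x₁ hx)

theorem exists_of_K_lt {B : ℝ≥0∞} (h : K N₀ N₁ t x < B) :
    ∃ x₀ x₁, x₀ + x₁ = x ∧ N₀ x₀ + ENNReal.ofReal t * N₁ x₁ < B := by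
  simpa only [K, iInf_lt_iff, exists_prop] using h

theorem K_mono (hst : s ≤ t) : K N₀ N₁ s x ≤ K N₀ N₁ t x :=
  le_K fun x₀ x₁ hx => hx ▸ (K_add_le N₀ N₁ s x₀ x₁).trans (by gcongr)

theorem K_le_div_mul (hs : 0 < s) (hst : s ≤ t) :
    K N₀ N₁ t x ≤ ENNReal.ofReal (t / s) * K N₀ N₁ s x := by
  have hdiv : 1 ≤ t / s := (one_le_div hs).2 hst
  refine le_mul_K (ENNReal.ofReal_pos.2 (by linarith)).ne' ENNReal.ofReal_ne_top ?_
  rintro x₀ x₁ rfl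
  calc K N₀ N₁ t (x₀ + x₁) ≤ N₀ x₀ + ENNReal.ofReal t * N₁ x₁ := K_add_le ..
    _ ≤ ENNReal.ofReal (t / s) * N₀ x₀ + ENNReal.ofReal (t / s) * ENNReal.ofReal s * N₁ x₁ := by
        rw [← ENNReal.ofReal_mul (by linarith), div_mul_cancel₀ _ hs.ne']
        gcongr
        exact le_mul_of_one_le_left zero_le (ENNReal.one_le_ofReal.2 hdiv)
    _ = _ := by rw [mul_add, mul_assoc]

end KFunctional

section ImageNorm

variable {E F : Type*} [NormedAddCommGroup E] {j : E → F}

theorem imageNorm_apply (hj : Function.Injective j) (y : E) : imageNorm j (j y) = ‖y‖ₑ := by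
  simp [imageNorm, hj.eq_iff]

theorem mem_range_of_imageNorm_ne_top {x : F} (h : imageNorm j x ≠ ∞) : x ∈ range j := by
  contrapose! h
  simpa [imageNorm] using h

end ImageNorm

/-! ### Discretized estimates for the K-functional -/

/-- The sequence `K(t_k, x) / φ(t_k)`, whose `ℓ_p` norm is `interpNorm`. -/
noncomputable def interpCoeff {A : Type*} [AddCommGroup A] (φ : ℝ → ℝ) (t : ℤ → ℝ)
    (N₀ N₁ : A → ℝ≥0∞) (x : A) (k : ℤ) : ℝ≥0∞ :=
  K N₀ N₁ (t k) x / ENNReal.ofReal (φ (t k))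

section Estimates

variable {A : Type*} [AddCommGroup A] {N₀ N₁ : A → ℝ≥0∞} {f : ℝ → ℝ} {τ v w : ℤ → ℝ} {p : ℝ≥0∞}

theorem interpNorm_eq (x : A) :
    interpNorm f τ p N₀ N₁ x = lpENorm p (interpCoeff f τ N₀ N₁ x) := rfl

theorem ofReal_mul_interpCoeff {k : ℤ} (hf : 0 < f (τ k)) (x : A) :
    ENNReal.ofReal (f (τ k)) * interpCoeff f τ N₀ N₁ x k = K N₀ N₁ (τ k) x :=
  ENNReal.mul_div_cancel (ENNReal.ofReal_pos.2 hf).ne' ENNReal.ofReal_ne_top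

theorem IsDiscretizing.exists_K_le (hτ : IsDiscretizing f τ) (x : A) {u : ℝ} (hu : 0 < u) :
    ∃ i, K N₀ N₁ u x ≤ ENNReal.ofReal (f (τ i) * min 1 (u / τ i)) *
      (2 * neighbourSum (interpCoeff f τ N₀ N₁ x) i) := by
  set β := interpCoeff f τ N₀ N₁ x
  have hτ₀ := hτ.strongIncr.1
  have hK : ∀ i, K N₀ N₁ (τ i) x = ENNReal.ofReal (f (τ i)) * β i := fun i =>
    (ofReal_mul_interpCoeff (hτ.strongIncr_comp.1 i) x).symm
  have hdouble : ∀ a b, ENNReal.ofReal (2 * a) * b = ENNReal.ofReal a * (2 * b) := fun a b => by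
    rw [ENNReal.ofReal_mul zero_le_two, ENNReal.ofReal_ofNat]
    ring
  obtain ⟨i, hi, hi'⟩ := hτ.strongIncr.exists_mem_Ico hu
  obtain ⟨Z₁, Z₂, hcover, -, h₁, h₂⟩ := hτ.decomposition
  rcases hcover.ge (mem_univ i) with hZ | hZ
  · refine ⟨i, ?_⟩
    rw [min_eq_left ((one_le_div (hτ₀ i)).2 hi), mul_one]
    calc K N₀ N₁ u x ≤ K N₀ N₁ (τ (i + 1)) x := K_mono hi'.le
      _ = ENNReal.ofReal (f (τ (i + 1))) * β (i + 1) := hK _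
      _ ≤ ENNReal.ofReal (2 * f (τ i)) * neighbourSum β i := by
          gcongr
          exacts [h₁ i hZ, succ_le_neighbourSum β i]
      _ = _ := hdouble ..
  · refine ⟨i + 1, ?_⟩
    rw [min_eq_right ((div_le_one (hτ₀ _)).2 hi'.le), mul_div_left_comm]
    calc K N₀ N₁ u x ≤ ENNReal.ofReal (u / τ i) * K N₀ N₁ (τ i) x := K_le_div_mul (hτ₀ i) hi
      _ = ENNReal.ofReal (u * (f (τ i) / τ i)) * β i := by
          rw [hK, ← mul_assoc, ← ENNReal.ofReal_mul (div_pos hu (hτ₀ i)).le,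
            mul_div_left_comm, mul_comm (f _)]
      _ ≤ ENNReal.ofReal (2 * (u * (f (τ (i + 1)) / τ (i + 1)))) * neighbourSum β (i + 1) := by
          rw [mul_left_comm]
          gcongr
          · exact h₂ i hZ
          · simpa using pred_le_neighbourSum β (i + 1)
      _ = _ := hdouble ..

theorem IsDiscretizing.tsum_atoms_div_le (hτ : IsDiscretizing f τ) (hf : IsQuasiConcave f)
    {s B M : ℝ} (hs : 0 < s) (hB : 0 < B) (hM : f s ≤ M * B) :
    ∑' i, ENNReal.ofReal (f (τ i) * (min 1 (s / τ i) / B)) ≤ ENNReal.ofReal (4 * M) := by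
  calc ∑' i, ENNReal.ofReal (f (τ i) * (min 1 (s / τ i) / B))
      = (∑' i, ENNReal.ofReal (f (τ i) * min 1 (s / τ i))) / ENNReal.ofReal B := by
        simp only [← mul_div_assoc, ENNReal.ofReal_div_of_pos hB]
        simp only [div_eq_mul_inv, ENNReal.tsum_mul_right]
    _ ≤ ENNReal.ofReal (4 * f s) / ENNReal.ofReal B := by
        gcongr
        exact hτ.tsum_atoms_le hf hs
    _ ≤ ENNReal.ofReal (4 * M) := by
        rw [← ENNReal.ofReal_div_of_pos hB]
        refine ENNReal.ofReal_le_ofReal ((div_le_iff₀ hB).2 ?_)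
        linarith

theorem IsScale.tsum_mul_dual_atoms_le (h : IsScale v w) (hf : IsQuasiConcave f) {G : Set ℤ}
    {M : ℝ} (hM : 0 ≤ M) (hG : ∀ k ∈ G, f (v k) ≤ M * w k) {s : ℝ} (hs : 0 < s) :
    ∑' k, G.indicator (fun k => ENNReal.ofReal (f s * (min 1 (v k / s) / w k))) k ≤
      ENNReal.ofReal (4 * M) := by
  have hfs := hf.pos s hs
  calc ∑' k, G.indicator (fun k => ENNReal.ofReal (f s * (min 1 (v k / s) / w k))) k
      = ENNReal.ofReal (f s) *
          ∑' k, G.indicator (fun k => ENNReal.ofReal (min 1 (v k / s) / w k)) k := by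
        simp only [ENNReal.ofReal_mul hfs.le, indicator_const_mul, ENNReal.tsum_mul_left]
    _ ≤ ENNReal.ofReal (f s) * ENNReal.ofReal (4 * (M / f s)) := by
        gcongr
        exact h.tsum_dual_atoms_le hf hM hG hs
    _ = ENNReal.ofReal (4 * M) := by
        rw [← ENNReal.ofReal_mul hfs.le]
        congr 1
        field_simp

theorem lpENorm_indicator_K_le (hp₁ : 1 ≤ p) (hf : IsQuasiConcave f) (hτ : IsDiscretizing f τ)
    (h : IsScale v w) {G : Set ℤ} {M : ℝ} (hM : 0 ≤ M) (hG : ∀ k ∈ G, f (v k) ≤ M * w k) (x : A) :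
    lpENorm p (G.indicator fun k => K N₀ N₁ (v k) x / ENNReal.ofReal (w k)) ≤
      24 * ENNReal.ofReal M * interpNorm f τ p N₀ N₁ x := by
  have hp₀ : p ≠ 0 := (zero_lt_one.trans_le hp₁).ne'
  set β := interpCoeff f τ N₀ N₁ x
  let c : ℤ → ℤ → ℝ≥0∞ := fun k i =>
    G.indicator (fun k => ENNReal.ofReal (f (τ i) * (min 1 (v k / τ i) / w k))) k
  have hle : ∀ k, G.indicator (fun k => K N₀ N₁ (v k) x / ENNReal.ofReal (w k)) k ≤
      ∑' i, c k i * (2 * neighbourSum β i) := fun k => by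
    refine indicator_apply_le' (fun hk => ?_) fun _ => zero_le
    obtain ⟨i, hi⟩ := hτ.exists_K_le x (h.pos k)
    refine le_trans ?_ (ENNReal.le_tsum i)
    simp only [c, indicator_of_mem hk, ← mul_div_assoc,
      ENNReal.ofReal_div_of_pos (h.strongIncr.1 k)]
    rw [← ENNReal.mul_div_right_comm]
    gcongr
  have hrow : ∀ k, ∑' i, c k i ≤ ENNReal.ofReal (4 * M) := fun k => by
    by_cases hk : k ∈ G
    · simpa only [c, indicator_of_mem hk] using
        hτ.tsum_atoms_div_le hf (h.pos k) (h.strongIncr.1 k) (hG k hk)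
    · simp [c, hk]
  have hcol : ∀ i, ∑' k, c k i ≤ ENNReal.ofReal (4 * M) := fun i =>
    h.tsum_mul_dual_atoms_le hf hM hG (hτ.strongIncr.1 i)
  calc _ ≤ lpENorm p fun k => ∑' i, c k i * (2 * neighbourSum β i) := lpENorm_mono hle
    _ ≤ ENNReal.ofReal (4 * M) * (2 * (3 * lpENorm p β)) := by
        refine (lpENorm_schur hp₁ hrow hcol _).trans ?_
        rw [lpENorm_const_mul hp₀]
        gcongr
        exact lpENorm_neighbourSum_le hp₁ β
    _ = 24 * ENNReal.ofReal M * interpNorm f τ p N₀ N₁ x := by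
        rw [interpNorm_eq, ENNReal.ofReal_mul (by norm_num), ENNReal.ofReal_ofNat]
        ring

theorem tsum_indicator_ofReal_inv_le {μ : ℤ → ℝ}
    (hμ : StronglyIncreasing μ ∨ StronglyDecreasing μ) {G : Set ℤ} {B : ℝ}
    (hG : ∀ m ∈ G, (μ m)⁻¹ ≤ B) :
    ∑' m, G.indicator (fun m => ENNReal.ofReal (μ m)⁻¹) m ≤ ENNReal.ofReal (2 * B) :=
  hμ.elim (fun h => h.inv.tsum_indicator_le hG) fun h => h.inv.tsum_indicator_le hG

theorem tsum_tsum_atoms_div_le (hf : IsQuasiConcave f) (hτ : IsDiscretizing f τ) {μ : ℤ → ℝ}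
    (hμ : StronglyIncreasing μ ∨ StronglyDecreasing μ) {G : Set ℤ} {s B : ℝ} (hs : 0 < s)
    (hB : 0 < B) (hG : ∀ m ∈ G, B ≤ μ m * f s) :
    ∑' m, ∑' i, G.indicator (fun m => ENNReal.ofReal (B * min 1 (τ i / s) / (μ m * f (τ i)))) m ≤
      8 := by
  have hfs := hf.pos s hs
  have hμ₀ : ∀ m, 0 < μ m := hμ.elim (·.1) (·.1)
  have hinv : ∀ m ∈ G, (μ m)⁻¹ ≤ f s / B := fun m hm => by
    rw [inv_le_comm₀ (hμ₀ m) (by positivity), inv_div, div_le_iff₀ hfs]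
    exact hG m hm
  have hfactor : ∀ m i, ENNReal.ofReal (B * min 1 (τ i / s) / (μ m * f (τ i))) =
      ENNReal.ofReal (μ m)⁻¹ * (ENNReal.ofReal B * ENNReal.ofReal (min 1 (τ i / s) / f (τ i))) :=
    fun m i => by
      rw [← ENNReal.ofReal_mul hB.le, ← ENNReal.ofReal_mul (inv_pos.2 (hμ₀ m)).le]
      congr 1
      ring
  calc ∑' m, ∑' i, G.indicator (fun m => ENNReal.ofReal (B * min 1 (τ i / s) / (μ m * f (τ i)))) m
      = (∑' m, G.indicator (fun m => ENNReal.ofReal (μ m)⁻¹) m) *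
          (ENNReal.ofReal B * ∑' i, ENNReal.ofReal (min 1 (τ i / s) / f (τ i))) := by
        simp only [hfactor, indicator_mul_const, ENNReal.tsum_mul_left, ENNReal.tsum_mul_right]
    _ ≤ ENNReal.ofReal (2 * (f s / B)) * (ENNReal.ofReal B * ENNReal.ofReal (4 / f s)) := by
        gcongr
        exacts [tsum_indicator_ofReal_inv_le hμ hinv, hτ.tsum_dual_atoms_le hf hs]
    _ = 8 := by
        rw [← ENNReal.ofReal_mul hB.le, ← ENNReal.ofReal_mul (by positivity),
          ← ENNReal.ofReal_ofNat 8]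
        congr 1
        field_simp
        norm_num

theorem lpENorm_interpNorm_div_le (hp₁ : 1 ≤ p) (hf : IsQuasiConcave f) (hτ : IsDiscretizing f τ)
    (h : IsScale v w) {μ : ℤ → ℝ} (hμ : StronglyIncreasing μ ∨ StronglyDecreasing μ)
    {G : ℤ → Set ℤ} (hG : ∀ m, ∀ k ∈ G m, w k ≤ μ m * f (v k)) (γ : ℤ → ℝ≥0∞) (y : ℤ → A)
    (hy : ∀ m s, 0 < s → K N₀ N₁ s (y m) ≤
      ∑' k, (G m).indicator (fun k => ENNReal.ofReal (w k * min 1 (s / v k))) k * γ k) :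
    lpENorm p (fun m => interpNorm f τ p N₀ N₁ (y m) / ENNReal.ofReal (μ m)) ≤
      8 * lpENorm p γ := by
  have hp₀ : p ≠ 0 := (zero_lt_one.trans_le hp₁).ne'
  have hμ₀ : ∀ m, 0 < μ m := hμ.elim (·.1) (·.1)
  have hf₀ := hτ.strongIncr_comp.1
  have hμf : ∀ m i, 0 < μ m * f (τ i) := fun m i => mul_pos (hμ₀ m) (hf₀ i)
  let c : ℤ × ℤ → ℤ → ℝ≥0∞ := fun q k =>
    (G q.1).indicator (fun k => ENNReal.ofReal (w k * min 1 (τ q.2 / v k))) k /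
      ENNReal.ofReal (μ q.1 * f (τ q.2))
  have hle : ∀ m, interpNorm f τ p N₀ N₁ (y m) / ENNReal.ofReal (μ m) ≤
      lpENorm p fun i => ∑' k, c (m, i) k * γ k := fun m => by
    rw [interpNorm_eq, div_eq_mul_inv, mul_comm, ← lpENorm_const_mul hp₀]
    refine lpENorm_mono fun i => ?_
    simp only [c, interpCoeff, div_eq_mul_inv, mul_right_comm _ _ (γ _), ENNReal.tsum_mul_right,
      ENNReal.ofReal_mul (hμ₀ m).le]
    rw [ENNReal.mul_inv (.inr ENNReal.ofReal_ne_top) (.inl ENNReal.ofReal_ne_top), mul_left_comm]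
    gcongr
    exact hy m _ (hτ.strongIncr.1 i)
  have hrow : ∀ q, ∑' k, c q k ≤ 8 := fun ⟨m, i⟩ => by
    simp only [c, div_eq_mul_inv, ENNReal.tsum_mul_right]
    rw [← div_eq_mul_inv]
    refine ENNReal.div_le_of_le_mul
      ((h.tsum_atoms_le hf (hμ₀ m).le (hG m) (hτ.strongIncr.1 i)).trans ?_)
    rw [ENNReal.ofReal_mul (by norm_num), ENNReal.ofReal_ofNat]
    gcongr
    norm_num
  have hcol : ∀ k, ∑' q, c q k ≤ 8 := fun k => by
    have hc : ∀ m i, c (m, i) k = {m | k ∈ G m}.indicator (fun m =>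
        ENNReal.ofReal (w k * min 1 (τ i / v k) / (μ m * f (τ i)))) m := fun m i => by
      by_cases hk : k ∈ G m <;> simp [c, hk, ENNReal.ofReal_div_of_pos (hμf m i)]
    rw [ENNReal.tsum_prod (f := fun m i => c (m, i) k)]
    simp only [hc]
    exact tsum_tsum_atoms_div_le hf hτ hμ (h.pos k) (h.strongIncr.1 k) fun m hm => hG m k hm
  calc _ ≤ lpENorm p fun m => lpENorm p fun i => ∑' k, c (m, i) k * γ k := lpENorm_mono hle
    _ = lpENorm p fun q => ∑' k, c q k * γ k :=
        (lpENorm_prod hp₀ fun m i => ∑' k, c (m, i) k * γ k).symm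
    _ ≤ 8 * lpENorm p γ := lpENorm_schur hp₁ hrow hcol γ

theorem le_atom_of_le_two_mul {k : ℤ} (hf : 0 < f (τ k)) (hf' : 0 < f (τ (k + 1)))
    (hle : f (τ (k + 1)) ≤ 2 * f (τ k)) {s : ℝ} {x : A} {B : ℝ≥0∞}
    (h₁ : B ≤ 4 * K N₀ N₁ (τ (k + 1)) x)
    (h₂ : B ≤ 4 * (ENNReal.ofReal (s / τ k) * K N₀ N₁ (τ k) x)) :
    B ≤ ENNReal.ofReal (f (τ k) * min 1 (s / τ k)) *
      (8 * neighbourSum (interpCoeff f τ N₀ N₁ x) k) := by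
  set α := interpCoeff f τ N₀ N₁ x
  rcases min_choice 1 (s / τ k) with h | h <;> rw [h]
  · calc B ≤ 4 * (ENNReal.ofReal (f (τ (k + 1))) * α (k + 1)) := by
          rwa [ofReal_mul_interpCoeff hf']
      _ ≤ 4 * (ENNReal.ofReal (2 * f (τ k)) * neighbourSum α k) := by
          gcongr
          exact succ_le_neighbourSum α k
      _ = _ := by
          rw [ENNReal.ofReal_mul zero_le_two, ENNReal.ofReal_ofNat, mul_one]
          ring
  · calc B ≤ 4 * (ENNReal.ofReal (s / τ k) * (ENNReal.ofReal (f (τ k)) * α k)) := by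
          rwa [ofReal_mul_interpCoeff hf]
      _ ≤ 8 * (ENNReal.ofReal (s / τ k) * (ENNReal.ofReal (f (τ k)) * neighbourSum α k)) := by
          gcongr
          · norm_num
          · exact self_le_neighbourSum α k
      _ = _ := by
          rw [ENNReal.ofReal_mul hf.le]
          ring

theorem le_atom_of_div_le_two_mul {k : ℤ} (hf : 0 < f (τ k)) (hf' : 0 < f (τ (k + 1)))
    (hle : f (τ k) / τ k ≤ 2 * (f (τ (k + 1)) / τ (k + 1))) {s : ℝ} (hs : 0 < s) {x : A}
    {B : ℝ≥0∞} (h₁ : B ≤ 4 * K N₀ N₁ (τ (k + 1)) x)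
    (h₂ : B ≤ 4 * (ENNReal.ofReal (s / τ k) * K N₀ N₁ (τ k) x)) :
    B ≤ ENNReal.ofReal (f (τ (k + 1)) * min 1 (s / τ (k + 1))) *
      (8 * neighbourSum (interpCoeff f τ N₀ N₁ x) (k + 1)) := by
  set α := interpCoeff f τ N₀ N₁ x
  rcases min_choice 1 (s / τ (k + 1)) with h | h <;> rw [h]
  · calc B ≤ 4 * (ENNReal.ofReal (f (τ (k + 1))) * α (k + 1)) := by
          rwa [ofReal_mul_interpCoeff hf']
      _ ≤ 8 * (ENNReal.ofReal (f (τ (k + 1))) * neighbourSum α (k + 1)) := by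
          gcongr
          · norm_num
          · exact self_le_neighbourSum α (k + 1)
      _ = _ := by
          rw [mul_one]
          ring
  · have hpred : α k ≤ neighbourSum α (k + 1) := by simpa using pred_le_neighbourSum α (k + 1)
    calc B ≤ 4 * (ENNReal.ofReal (s / τ k) * (ENNReal.ofReal (f (τ k)) * α k)) := by
          rwa [ofReal_mul_interpCoeff hf]
      _ = 4 * (ENNReal.ofReal (s * (f (τ k) / τ k)) * α k) := by
          rw [← mul_assoc (ENNReal.ofReal _), ← ENNReal.ofReal_mul' hf.le, div_mul_eq_mul_div,
            mul_div_assoc]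
      _ ≤ 4 * (ENNReal.ofReal (s * (2 * (f (τ (k + 1)) / τ (k + 1)))) *
            neighbourSum α (k + 1)) := by gcongr
      _ = _ := by
          rw [mul_left_comm s, ENNReal.ofReal_mul zero_le_two, ENNReal.ofReal_ofNat,
            mul_div_left_comm s]
          ring

theorem interpNorm_le_of_forall_add_eq (hp₁ : 1 ≤ p) (hτ : ∀ m, 0 < τ m) {x : A}
    {y z : ℤ → A} (hx : ∀ m, y m + z m = x) :
    interpNorm f τ p N₀ N₁ x ≤
      lpENorm p (fun m => N₀ (y m) / ENNReal.ofReal (f (τ m))) +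
        lpENorm p (fun m => N₁ (z m) / ENNReal.ofReal (f (τ m) / τ m)) := by
  refine (lpENorm_mono fun m => ?_).trans (lpENorm_add_le hp₁ _ _)
  have hτm := hτ m
  have hdiv : ENNReal.ofReal (τ m) * N₁ (z m) / ENNReal.ofReal (f (τ m)) =
      N₁ (z m) / ENNReal.ofReal (f (τ m) / τ m) := by
    rw [ENNReal.ofReal_div_of_pos hτm, ← ENNReal.div_mul _ (.inr (ENNReal.ofReal_pos.2 hτm).ne')
      (.inr ENNReal.ofReal_ne_top), mul_comm, ENNReal.mul_div_right_comm]
  calc interpCoeff f τ N₀ N₁ x m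
      ≤ (N₀ (y m) + ENNReal.ofReal (τ m) * N₁ (z m)) / ENNReal.ofReal (f (τ m)) := by
        rw [interpCoeff, ← hx m]
        gcongr
        exact K_add_le ..
    _ = _ := by rw [ENNReal.add_div, hdiv]

end Estimates

theorem hasSum_telescope {A : Type*} [AddCommGroup A] [TopologicalSpace A]
    [IsTopologicalAddGroup A] [T2Space A] {g : ℤ → A} {x x' y : A}
    (hx : Tendsto (fun n : ℕ => g n) atTop (𝓝 x))
    (hx' : Tendsto (fun n : ℕ => g (-n)) atTop (𝓝 x'))
    (hy : HasSum (fun k => g (k + 1) - g k) y) : y = x - x' := by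
  have hpart : ∀ n : ℕ, ∑ i ∈ Finset.range n, (g ((i : ℤ) + 1) - g i +
      (g (-((i : ℤ) + 1) + 1) - g (-((i : ℤ) + 1)))) = g n - g (-n) := fun n => by
    induction n with
    | zero => simp
    | succ n ih =>
      rw [Finset.sum_range_succ, ih, show -((n : ℤ) + 1) + 1 = -n by ring]
      push_cast
      abel
  refine tendsto_nhds_unique hy.nat_add_neg_add_one.tendsto_sum_nat ?_
  simpa only [hpart] using hx.sub hx'

theorem tendsto_zero_of_enorm_le {E : Type*} [NormedAddCommGroup E] {a : ℕ → E} {c : ℕ → ℝ}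
    {R : ℝ≥0∞} (hR : R ≠ ∞) (hc : Tendsto c atTop (𝓝 0))
    (h : ∀ n, ‖a n‖ₑ ≤ R * ENNReal.ofReal (c n)) : Tendsto a atTop (𝓝 0) := by
  have hc' : Tendsto (fun n => R * ENNReal.ofReal (c n)) atTop (𝓝 0) := by
    simpa using ENNReal.Tendsto.const_mul (ENNReal.tendsto_ofReal hc) (.inr hR)
  exact tendsto_zero_iff_enorm_tendsto_zero.2
    (tendsto_of_tendsto_of_tendsto_of_le_of_le tendsto_const_nhds hc' (fun _ => zero_le) h)

/-! ### Banach couples -/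

namespace BanachCouple

variable {𝕜 : Type*} [RCLike 𝕜] {X₀ X₁ A : Type*}
  [NormedAddCommGroup X₀] [NormedSpace 𝕜 X₀] [CompleteSpace X₀]
  [NormedAddCommGroup X₁] [NormedSpace 𝕜 X₁] [CompleteSpace X₁]
  [AddCommGroup A] [Module 𝕜 A] [TopologicalSpace A] [IsTopologicalAddGroup A]
  [ContinuousSMul 𝕜 A] [T2Space A] (X : BanachCouple 𝕜 X₀ X₁ A)

/-- The K-functional `K(t, x; X)` of a Banach couple `X`. -/
noncomputable def kFun (t : ℝ) (x : A) : ℝ≥0∞ :=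
  K (imageNorm X.incl₀) (imageNorm X.incl₁) t x

theorem kFun_le (t : ℝ) (y : X₀) (z : X₁) :
    X.kFun t (X.incl₀ y + X.incl₁ z) ≤ ‖y‖ₑ + ENNReal.ofReal t * ‖z‖ₑ := by
  simpa only [kFun, imageNorm_apply X.injective₀, imageNorm_apply X.injective₁] using
    K_add_le (imageNorm X.incl₀) (imageNorm X.incl₁) t (X.incl₀ y) (X.incl₁ z)

theorem kFun_zero (t : ℝ) : X.kFun t 0 = 0 := by simpa using X.kFun_le t 0 0

variable {X}

theorem exists_of_kFun_lt {t : ℝ} (ht : 0 < t) {x : A} {B : ℝ≥0∞} (h : X.kFun t x < B) :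
    ∃ (y : X₀) (z : X₁), X.incl₀ y + X.incl₁ z = x ∧ ‖y‖ₑ + ENNReal.ofReal t * ‖z‖ₑ < B := by
  obtain ⟨x₀, x₁, hx, hlt⟩ := exists_of_K_lt h
  have hy : imageNorm X.incl₀ x₀ ≠ ∞ := ne_top_of_le_ne_top hlt.ne_top le_self_add
  have hz : imageNorm X.incl₁ x₁ ≠ ∞ := fun h => by
    rw [h, ENNReal.mul_top (ENNReal.ofReal_pos.2 ht).ne', add_top] at hlt
    exact not_top_lt hlt
  obtain ⟨y, rfl⟩ := mem_range_of_imageNorm_ne_top hy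
  obtain ⟨z, rfl⟩ := mem_range_of_imageNorm_ne_top hz
  rw [imageNorm_apply X.injective₀, imageNorm_apply X.injective₁] at hlt
  exact ⟨y, z, hx, hlt⟩

theorem exists_decomposition_of_tsum {ι : Type*} [Countable ι] {u : ι → A} {t : ℝ} (ht : 0 < t)
    (hfin : ∑' k, X.kFun t (u k) ≠ ∞) {ε : ℝ≥0} (hε : 0 < ε) :
    ∃ (y : X₀) (z : X₁), HasSum u (X.incl₀ y + X.incl₁ z) ∧
      ‖y‖ₑ + ENNReal.ofReal t * ‖z‖ₑ ≤ (∑' k, X.kFun t (u k)) + ε := by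
  obtain ⟨δ, hδ, hδsum⟩ := ENNReal.exists_pos_sum_of_countable' (ENNReal.coe_pos.2 hε).ne' ι
  have hex : ∀ k, ∃ (y : X₀) (z : X₁), X.incl₀ y + X.incl₁ z = u k ∧
      ‖y‖ₑ + ENNReal.ofReal t * ‖z‖ₑ < X.kFun t (u k) + δ k := fun k =>
    exists_of_kFun_lt ht (ENNReal.lt_add_right (ENNReal.ne_top_of_tsum_ne_top hfin k) (hδ k).ne')
  choose y z hyz hlt using hex
  have htot : (∑' k, ‖y k‖ₑ) + ENNReal.ofReal t * ∑' k, ‖z k‖ₑ ≤ (∑' k, X.kFun t (u k)) + ε := by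
    rw [← ENNReal.tsum_mul_left, ← ENNReal.tsum_add]
    refine (ENNReal.tsum_le_tsum fun k => (hlt k).le).trans ?_
    rw [ENNReal.tsum_add]
    gcongr
  have hne : (∑' k, X.kFun t (u k)) + ε ≠ ∞ := ENNReal.add_ne_top.2 ⟨hfin, ENNReal.coe_ne_top⟩
  have hy : Summable y := .of_enorm (ne_top_of_le_ne_top hne (le_self_add.trans htot))
  have hz : Summable z := .of_enorm fun h => by
    rw [h, ENNReal.mul_top (ENNReal.ofReal_pos.2 ht).ne', add_top] at htot
    exact hne (top_le_iff.1 htot)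
  refine ⟨∑' k, y k, ∑' k, z k, ?_, le_trans ?_ htot⟩
  · simpa only [hyz] using (hy.hasSum.mapL X.incl₀).add (hz.hasSum.mapL X.incl₁)
  · gcongr <;> exact enorm_tsum_le_tsum_enorm

theorem summable_of_tsum_kFun_ne_top {ι : Type*} [Countable ι] {u : ι → A} {t : ℝ} (ht : 0 < t)
    (hfin : ∑' k, X.kFun t (u k) ≠ ∞) : Summable u :=
  have ⟨_, _, h, _⟩ := exists_decomposition_of_tsum ht hfin one_pos
  h.summable

theorem kFun_le_tsum {ι : Type*} [Countable ι] {u : ι → A} {x : A} (hu : HasSum u x) {t : ℝ}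
    (ht : 0 < t) : X.kFun t x ≤ ∑' k, X.kFun t (u k) := by
  by_cases hfin : ∑' k, X.kFun t (u k) = ∞
  · exact hfin ▸ le_top
  refine ENNReal.le_of_forall_pos_le_add fun ε hε _ => ?_
  obtain ⟨y, z, h, hle⟩ := exists_decomposition_of_tsum ht hfin hε
  exact hu.unique h ▸ (X.kFun_le t y z).trans hle

theorem kFun_add_le {t : ℝ} (ht : 0 < t) (x y : A) :
    X.kFun t (x + y) ≤ X.kFun t x + X.kFun t y := by
  simpa using X.kFun_le_tsum (hasSum_fintype fun b : Bool => cond b x y) ht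

theorem eq_zero_of_kFun_eq_zero {t : ℝ} (ht : 0 < t) {x : A} (h : X.kFun t x = 0) : x = 0 := by
  -- The constant series `x + x + ⋯` converges.
  have hsum : Summable fun _ : ℕ => x := summable_of_tsum_kFun_ne_top (X := X) ht (by simp [h])
  exact tendsto_const_nhds_iff.1 hsum.tendsto_atTop_zero

theorem exists_near_optimal {t : ℝ} (ht : 0 < t) {x : A} (hx : X.kFun t x ≠ ∞) :
    ∃ (y : X₀) (z : X₁), X.incl₀ y + X.incl₁ z = x ∧
      ‖y‖ₑ + ENNReal.ofReal t * ‖z‖ₑ ≤ 2 * X.kFun t x := by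
  rcases eq_or_ne (X.kFun t x) 0 with h₀ | h₀
  · exact ⟨0, 0, by simp [eq_zero_of_kFun_eq_zero ht h₀], by simp⟩
  · have hlt : X.kFun t x < 2 * X.kFun t x := by
      rw [two_mul]
      exact ENNReal.lt_add_right hx h₀
    obtain ⟨y, z, hyz, hle⟩ := exists_of_kFun_lt ht hlt
    exact ⟨y, z, hyz, hle.le⟩

/-! ### Atomic decompositions -/

variable {x : A}

theorem enorm_sub_le_of_near_optimal {s t : ℝ} (hs : 0 < s) (hst : s ≤ t) {y y' : X₀} {z z' : X₁}
    (h : ‖y‖ₑ + ENNReal.ofReal s * ‖z‖ₑ ≤ 2 * X.kFun s x)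
    (h' : ‖y'‖ₑ + ENNReal.ofReal t * ‖z'‖ₑ ≤ 2 * X.kFun t x) :
    ‖y' - y‖ₑ ≤ 4 * X.kFun t x ∧ ENNReal.ofReal s * ‖z - z'‖ₑ ≤ 4 * X.kFun s x := by
  have hts : 0 < t / s := div_pos (hs.trans_le hst) hs
  have hy : ‖y‖ₑ ≤ 2 * X.kFun t x := (le_self_add.trans h).trans (by
    gcongr
    exact K_mono hst)
  have hz' : ENNReal.ofReal s * ‖z'‖ₑ ≤ 2 * X.kFun s x := by
    rw [← ENNReal.mul_le_mul_iff_right (ENNReal.ofReal_pos.2 hts).ne' ENNReal.ofReal_ne_top,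
      ← mul_assoc, ← ENNReal.ofReal_mul hts.le, div_mul_cancel₀ _ hs.ne']
    calc ENNReal.ofReal t * ‖z'‖ₑ ≤ 2 * X.kFun t x := le_add_self.trans h'
      _ ≤ 2 * (ENNReal.ofReal (t / s) * X.kFun s x) := by
          gcongr
          exact K_le_div_mul hs hst
      _ = _ := mul_left_comm ..
  constructor
  · calc ‖y' - y‖ₑ ≤ ‖y'‖ₑ + ‖y‖ₑ := enorm_sub_le
      _ ≤ 2 * X.kFun t x + 2 * X.kFun t x := add_le_add (le_self_add.trans h') hy
      _ = _ := by ring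
  · calc ENNReal.ofReal s * ‖z - z'‖ₑ ≤ ENNReal.ofReal s * (‖z‖ₑ + ‖z'‖ₑ) := by
          gcongr
          exact enorm_sub_le
      _ ≤ 2 * X.kFun s x + 2 * X.kFun s x := by
          rw [mul_add]
          exact add_le_add (le_add_self.trans h) hz'
      _ = _ := by ring

theorem kFun_sub_le_of_near_optimal {s t : ℝ} (hs : 0 < s) (hst : s ≤ t) {y y' : X₀} {z z' : X₁}
    (hx : X.incl₀ y + X.incl₁ z = x) (hx' : X.incl₀ y' + X.incl₁ z' = x)
    (h : ‖y‖ₑ + ENNReal.ofReal s * ‖z‖ₑ ≤ 2 * X.kFun s x)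
    (h' : ‖y'‖ₑ + ENNReal.ofReal t * ‖z'‖ₑ ≤ 2 * X.kFun t x) (r : ℝ) :
    X.kFun r (X.incl₀ y' - X.incl₀ y) ≤ 4 * X.kFun t x ∧
      X.kFun r (X.incl₀ y' - X.incl₀ y) ≤ 4 * (ENNReal.ofReal (r / s) * X.kFun s x) := by
  obtain ⟨hy, hz⟩ := enorm_sub_le_of_near_optimal hs hst h h'
  constructor
  · refine le_trans ?_ hy
    simpa using X.kFun_le r (y' - y) 0
  · have heq : X.incl₀ y' - X.incl₀ y = X.incl₁ (z - z') := by
      rw [map_sub, sub_eq_sub_iff_add_eq_add, hx', add_comm, hx]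
    calc X.kFun r (X.incl₀ y' - X.incl₀ y) ≤ ENNReal.ofReal r * ‖z - z'‖ₑ := by
          simpa [heq] using X.kFun_le r 0 (z - z')
      _ = ENNReal.ofReal (r / s) * (ENNReal.ofReal s * ‖z - z'‖ₑ) := by
          rw [← mul_assoc, ← ENNReal.ofReal_mul' hs.le, div_mul_cancel₀ _ hs.ne']
      _ ≤ ENNReal.ofReal (r / s) * (4 * X.kFun s x) := by gcongr
      _ = _ := mul_left_comm ..

theorem eq_of_hasSum_sub_of_near_optimal {v w : ℤ → ℝ} (h : IsScale v w) {R : ℝ≥0∞} (hR : R ≠ ∞)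
    (hK : ∀ k, X.kFun (v k) x ≤ R * ENNReal.ofReal (w k)) {y : ℤ → X₀} {z : ℤ → X₁}
    (hx : ∀ k, X.incl₀ (y k) + X.incl₁ (z k) = x)
    (hyz : ∀ k, ‖y k‖ₑ + ENNReal.ofReal (v k) * ‖z k‖ₑ ≤ 2 * X.kFun (v k) x) {x' : A}
    (hx' : HasSum (fun k => X.incl₀ (y (k + 1)) - X.incl₀ (y k)) x') : x' = x := by
  have hR' : 2 * R ≠ ∞ := ENNReal.mul_ne_top (by norm_num) hR
  have hle : ∀ k, ‖y k‖ₑ + ENNReal.ofReal (v k) * ‖z k‖ₑ ≤ 2 * R * ENNReal.ofReal (w k) :=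
    fun k => (hyz k).trans (by rw [mul_assoc]; gcongr; exact hK k)
  have hy : Tendsto (fun n : ℕ => y (-n)) atTop (𝓝 0) :=
    tendsto_zero_of_enorm_le hR' h.strongIncr.tendsto_neg fun n => le_self_add.trans (hle _)
  have hwv : Tendsto (fun n : ℕ => w n / v n) atTop (𝓝 0) :=
    h.strongDecr_div.inv.tendsto_atTop.inv_tendsto_atTop.congr fun n => inv_inv _
  have hz : Tendsto (fun n : ℕ => z n) atTop (𝓝 0) :=
    tendsto_zero_of_enorm_le hR' hwv fun n => by
      rw [ENNReal.ofReal_div_of_pos (h.pos n), ← mul_div_assoc,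
        ENNReal.le_div_iff_mul_le (.inl (ENNReal.ofReal_pos.2 (h.pos n)).ne')
          (.inl ENNReal.ofReal_ne_top), mul_comm]
      exact le_add_self.trans (hle n)
  have hright : Tendsto (fun n : ℕ => X.incl₀ (y n)) atTop (𝓝 x) := by
    have hlim := (tendsto_const_nhds (x := x)).sub
      ((X.incl₁.continuous.tendsto' 0 0 (map_zero _)).comp hz)
    rw [sub_zero] at hlim
    exact hlim.congr fun n => sub_eq_of_eq_add (hx n).symm
  have hleft : Tendsto (fun n : ℕ => X.incl₀ (y (-n))) atTop (𝓝 0) :=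
    (X.incl₀.continuous.tendsto' 0 0 (map_zero _)).comp hy
  simpa only [sub_zero] using hasSum_telescope (g := fun k => X.incl₀ (y k)) hright hleft hx'

theorem exists_differences {v w : ℤ → ℝ} (hv : Monotone v) (h : IsScale v w) {R : ℝ≥0∞}
    (hR : R ≠ ∞) (hK : ∀ k, X.kFun (v k) x ≤ R * ENNReal.ofReal (w k)) :
    ∃ u : ℤ → A, (∀ x', HasSum u x' → x' = x) ∧ ∀ k s,
      X.kFun s (u k) ≤ 4 * X.kFun (v (k + 1)) x ∧
      X.kFun s (u k) ≤ 4 * (ENNReal.ofReal (s / v k) * X.kFun (v k) x) := by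
  choose y z hx hyz using fun k => exists_near_optimal (h.pos k)
    (ne_top_of_le_ne_top (ENNReal.mul_ne_top hR ENNReal.ofReal_ne_top) (hK k))
  exact ⟨fun k => X.incl₀ (y (k + 1)) - X.incl₀ (y k),
    fun _ => eq_of_hasSum_sub_of_near_optimal h hR hK hx hyz,
    fun k => kFun_sub_le_of_near_optimal (h.pos k) (hv (by omega)) (hx k) (hx _) (hyz k) (hyz _)⟩

variable (X) in
/-- The terms `U k` are atoms of a Banach couple for the scale `v`, `w`, of size `γ k`: their
K-functionals are dominated by the multiples `γ k * w k * min 1 (s / v k)` of the extremal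
quasi-concave functions. -/
def IsAtomic (v w : ℤ → ℝ) (γ : ℤ → ℝ≥0∞) (U : ℤ → A) : Prop :=
  ∀ k s, 0 < s → X.kFun s (U k) ≤ ENNReal.ofReal (w k * min 1 (s / v k)) * γ k

namespace IsAtomic

variable {v w : ℤ → ℝ} {γ γ' : ℤ → ℝ≥0∞} {U U' : ℤ → A}

theorem add (hU : X.IsAtomic v w γ U) (hU' : X.IsAtomic v w γ' U') :
    X.IsAtomic v w (γ + γ') (U + U') := fun k s hs => by
  simp only [Pi.add_apply, mul_add]
  exact (kFun_add_le hs _ _).trans (add_le_add (hU k s hs) (hU' k s hs))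

theorem indicator (hU : X.IsAtomic v w γ U) (G : Set ℤ) :
    X.IsAtomic v w γ (G.indicator U) := fun k s hs => by
  by_cases hk : k ∈ G
  · simpa only [indicator_of_mem hk] using hU k s hs
  · simp [hk, kFun_zero]

theorem summable {ψ : ℝ → ℝ} (hψ : IsQuasiConcave ψ) (hv : IsDiscretizing ψ v) {R : ℝ≥0∞}
    (hR : R ≠ ∞) (hγ : ∀ k, γ k ≤ R) (hU : X.IsAtomic v (fun k => ψ (v k)) γ U) :
    Summable U := by
  refine summable_of_tsum_kFun_ne_top (X := X) one_pos (ne_top_of_le_ne_top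
    (ENNReal.mul_ne_top (ENNReal.ofReal_ne_top (r := 4 * ψ 1)) hR) ?_)
  calc ∑' k, X.kFun 1 (U k) ≤ ∑' k, ENNReal.ofReal (ψ (v k) * min 1 (1 / v k)) * R :=
        ENNReal.tsum_le_tsum fun k => (hU k 1 one_pos).trans (by gcongr; exact hγ k)
    _ ≤ ENNReal.ofReal (4 * ψ 1) * R := by
        rw [ENNReal.tsum_mul_right]
        gcongr
        exact hv.tsum_atoms_le hψ one_pos

theorem kFun_le_of_hasSum_indicator (hU : X.IsAtomic v w γ U) {G : Set ℤ}
    (hx : HasSum (G.indicator U) x) {s : ℝ} (hs : 0 < s) :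
    X.kFun s x ≤ ∑' k, G.indicator (fun k => ENNReal.ofReal (w k * min 1 (s / v k))) k * γ k := by
  refine (kFun_le_tsum hx hs).trans (ENNReal.tsum_le_tsum fun k => ?_)
  by_cases hk : k ∈ G
  · simpa only [indicator_of_mem hk] using hU k s hs
  · simp [hk, kFun_zero]

end IsAtomic

theorem isAtomic_indicator_of_le_two_mul {ψ : ℝ → ℝ} {v : ℤ → ℝ} {u : ℤ → A}
    (hψ : ∀ k, 0 < ψ (v k)) {Z : Set ℤ} (hZ : ∀ k ∈ Z, ψ (v (k + 1)) ≤ 2 * ψ (v k))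
    (hu : ∀ k s, X.kFun s (u k) ≤ 4 * X.kFun (v (k + 1)) x ∧
      X.kFun s (u k) ≤ 4 * (ENNReal.ofReal (s / v k) * X.kFun (v k) x)) :
    X.IsAtomic v (fun k => ψ (v k))
      (8 * neighbourSum (interpCoeff ψ v (imageNorm X.incl₀) (imageNorm X.incl₁) x))
      (Z.indicator u) := fun k s _ => by
  by_cases hk : k ∈ Z
  · rw [indicator_of_mem hk]
    exact le_atom_of_le_two_mul (hψ k) (hψ _) (hZ k hk) (hu k s).1 (hu k s).2
  · simp [hk, kFun_zero]

-- For these `k` the difference `u k` is an atom at `v (k + 1)`, whence the shift of the index.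
theorem isAtomic_indicator_subRight_of_div_le_two_mul {ψ : ℝ → ℝ} {v : ℤ → ℝ} {u : ℤ → A}
    (hψ : ∀ k, 0 < ψ (v k)) {Z : Set ℤ}
    (hZ : ∀ k ∈ Z, ψ (v k) / v k ≤ 2 * (ψ (v (k + 1)) / v (k + 1)))
    (hu : ∀ k s, X.kFun s (u k) ≤ 4 * X.kFun (v (k + 1)) x ∧
      X.kFun s (u k) ≤ 4 * (ENNReal.ofReal (s / v k) * X.kFun (v k) x)) :
    X.IsAtomic v (fun k => ψ (v k))
      (8 * neighbourSum (interpCoeff ψ v (imageNorm X.incl₀) (imageNorm X.incl₁) x))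
      (Z.indicator u ∘ Equiv.subRight 1) := fun k s hs => by
  obtain ⟨k, rfl⟩ : ∃ j, j + 1 = k := ⟨k - 1, sub_add_cancel k 1⟩
  by_cases hk : k ∈ Z
  · simpa [hk] using
      le_atom_of_div_le_two_mul (hψ k) (hψ _) (hZ k hk) hs (hu k s).1 (hu k s).2
  · simp [hk, kFun_zero]

theorem exists_isAtomic_hasSum {ψ : ℝ → ℝ} {v : ℤ → ℝ} (hψ : IsQuasiConcave ψ)
    (hv : IsDiscretizing ψ v) {R : ℝ≥0∞} (hR : R ≠ ∞)
    (hα : ∀ k, interpCoeff ψ v (imageNorm X.incl₀) (imageNorm X.incl₁) x k ≤ R) :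
    ∃ U : ℤ → A, HasSum U x ∧ X.IsAtomic v (fun k => ψ (v k))
      (16 * neighbourSum (interpCoeff ψ v (imageNorm X.incl₀) (imageNorm X.incl₁) x)) U := by
  set α := interpCoeff ψ v (imageNorm X.incl₀) (imageNorm X.incl₁) x
  have hψv := hv.strongIncr_comp.1
  have hK : ∀ k, X.kFun (v k) x ≤ R * ENNReal.ofReal (ψ (v k)) := fun k => by
    rw [kFun, ← ofReal_mul_interpCoeff (hψv k), mul_comm]
    gcongr
    exact hα k
  obtain ⟨u, hux, hu⟩ := exists_differences hv.strongIncr.monotone hv.isScale hR hK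
  obtain ⟨Z₁, Z₂, hcover, hdisj, hZ₁, hZ₂⟩ := hv.decomposition
  have hγ : ∀ k, (8 * neighbourSum α) k ≤ 8 * (3 * R) := fun k => by
    simpa using mul_le_mul_right (neighbourSum_le hα k) 8
  have hu₁ := isAtomic_indicator_of_le_two_mul hψv hZ₁ hu
  have hu₂ := isAtomic_indicator_subRight_of_div_le_two_mul hψv hZ₂ hu
  have hR' : 8 * (3 * R) ≠ ∞ := by finiteness
  have hs₁ := (hu₁.summable hψ hv hR' hγ).hasSum
  have hs₂ := (hu₂.summable hψ hv hR' hγ).hasSum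
  have hsum := hs₁.add ((Equiv.subRight 1).hasSum_iff.1 hs₂)
  rw [show (fun k => Z₁.indicator u k + Z₂.indicator u k) = u by
    rw [← indicator_union_of_disjoint (disjoint_iff.2 hdisj), hcover, indicator_univ]] at hsum
  refine ⟨Z₁.indicator u + Z₂.indicator u ∘ Equiv.subRight 1, hux _ hsum ▸ hs₁.add hs₂, ?_⟩
  convert hu₁.add hu₂ using 1
  ring

/-! ### Reiteration -/

variable {φ φ₀ φ₁ : ℝ → ℝ} {p : ℝ≥0∞} {τ z t t' : ℤ → ℝ}

theorem IsAtomic.interpNorm_interp_le (hp₁ : 1 ≤ p) (hφ : IsQuasiConcave φ)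
    (hφ₀ : IsQuasiConcave φ₀) (hφ₁ : IsQuasiConcave φ₁) (hτ : IsDiscretizing φ₀ τ)
    (hz : IsDiscretizing φ₁ z) (ht : IsDiscretizing φ t)
    (h : IsScale t' fun k => compose φ φ₀ φ₁ (t' k)) {γ : ℤ → ℝ≥0∞} {U : ℤ → A}
    (hU : X.IsAtomic t' (fun k => compose φ φ₀ φ₁ (t' k)) γ U)
    (hsum : ∀ G : Set ℤ, Summable (G.indicator U)) (hx : HasSum U x) :
    interpNorm φ t p (X.interp φ₀ τ p) (X.interp φ₁ z p) x ≤ 16 * lpENorm p γ := by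
  let r : ℤ → ℝ := fun k => φ₁ (t' k) / φ₀ (t' k)
  let G : ℤ → Set ℤ := fun m => {k | r k < t m}
  have h₀pos : ∀ k, 0 < φ₀ (t' k) := fun k => hφ₀.pos _ (h.pos k)
  have h₁pos : ∀ k, 0 < φ₁ (t' k) := fun k => hφ₁.pos _ (h.pos k)
  have hr : ∀ k, 0 < r k := fun k => div_pos (h₁pos k) (h₀pos k)
  have ht₀ := ht.strongIncr.1
  have hsplit : ∀ m, ∑' k, (G m).indicator U k + ∑' k, (G m)ᶜ.indicator U k = x := fun m => by
    rw [← (hsum _).tsum_add (hsum _), ← hx.tsum_eq]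
    exact congrArg tsum (indicator_self_add_compl (G m) U)
  have hlow : ∀ m, ∀ k ∈ G m, compose φ φ₀ φ₁ (t' k) ≤ φ (t m) * φ₀ (t' k) := fun m k hk => by
    rw [compose, mul_comm]
    exact mul_le_mul_of_nonneg_right (hφ.mono (hr k) (ht₀ m) (le_of_lt hk)) (h₀pos k).le
  have hhigh : ∀ m, ∀ k ∈ (G m)ᶜ, compose φ φ₀ φ₁ (t' k) ≤ φ (t m) / t m * φ₁ (t' k) :=
    fun m k hk => by
      calc compose φ φ₀ φ₁ (t' k) = φ (r k) / r k * φ₁ (t' k) := by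
            have := h₀pos k
            have := h₁pos k
            simp only [compose, r]
            field_simp
        _ ≤ φ (t m) / t m * φ₁ (t' k) := mul_le_mul_of_nonneg_right
            (hφ.anti (ht₀ m) (hr k) (not_lt.1 hk)) (h₁pos k).le
  calc interpNorm φ t p (X.interp φ₀ τ p) (X.interp φ₁ z p) x
      ≤ 8 * lpENorm p γ + 8 * lpENorm p γ :=
        (interpNorm_le_of_forall_add_eq hp₁ ht₀ hsplit).trans <| add_le_add
          (lpENorm_interpNorm_div_le hp₁ hφ₀ hτ h (.inl ht.strongIncr_comp) hlow γ _
            fun m s hs => hU.kFun_le_of_hasSum_indicator (hsum (G m)).hasSum hs)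
          (lpENorm_interpNorm_div_le hp₁ hφ₁ hz h (.inr ht.strongDecr_div) hhigh γ _
            fun m s hs => hU.kFun_le_of_hasSum_indicator (hsum (G m)ᶜ).hasSum hs)
    _ = 16 * lpENorm p γ := by ring

variable (X)

theorem interpNorm_interp_le (hp₁ : 1 ≤ p) (hφ : IsNondegQuasiConcave φ)
    (hφ₀ : IsNondegQuasiConcave φ₀) (hφ₁ : IsNondegQuasiConcave φ₁)
    (hτ : IsDiscretizing φ₀ τ) (hz : IsDiscretizing φ₁ z) (ht : IsDiscretizing φ t)
    (ht' : IsDiscretizing (compose φ φ₀ φ₁) t') (x : A) :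
    interpNorm φ t p (X.interp φ₀ τ p) (X.interp φ₁ z p) x ≤
      768 * X.interp (compose φ φ₀ φ₁) t' p x := by
  have hp₀ : p ≠ 0 := (zero_lt_one.trans_le hp₁).ne'
  by_cases hfin : X.interp (compose φ φ₀ φ₁) t' p x = ∞
  · simp [hfin, ENNReal.mul_top]
  set α := interpCoeff (compose φ φ₀ φ₁) t' (imageNorm X.incl₀) (imageNorm X.incl₁) x
  have hα : ∀ k, α k ≤ X.interp (compose φ φ₀ φ₁) t' p x := le_lpENorm hp₀ α
  have hψ := (hφ.compose hφ₀ hφ₁).isQuasiConcave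
  obtain ⟨U, hUx, hU⟩ := exists_isAtomic_hasSum hψ ht' hfin hα
  have hγ : ∀ k, (16 * neighbourSum α) k ≤ 16 * (3 * X.interp (compose φ φ₀ φ₁) t' p x) :=
    fun k => mul_le_mul_right (neighbourSum_le hα k) 16
  have hsum : ∀ G : Set ℤ, Summable (G.indicator U) := fun G =>
    (hU.indicator G).summable hψ ht' (by finiteness) hγ
  calc interpNorm φ t p (X.interp φ₀ τ p) (X.interp φ₁ z p) x
      ≤ 16 * lpENorm p (16 * neighbourSum α) :=
        hU.interpNorm_interp_le hp₁ hφ.isQuasiConcave hφ₀.isQuasiConcave hφ₁.isQuasiConcave hτ hz ht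
          ht'.isScale hsum hUx
    _ ≤ 16 * (16 * (3 * lpENorm p α)) := by
        gcongr
        exact (lpENorm_const_mul hp₀ _ _).trans_le
          (mul_le_mul_right (lpENorm_neighbourSum_le hp₁ α) 16)
    _ = 768 * lpENorm p α := by ring

theorem lpENorm_indicator_kFun_le (hp₁ : 1 ≤ p) (hφ₀ : IsQuasiConcave φ₀)
    (hφ₁ : IsQuasiConcave φ₁) (hτ : IsDiscretizing φ₀ τ) (hz : IsDiscretizing φ₁ z)
    {v w : ℤ → ℝ} (h : IsScale v w) {G : Set ℤ} {s M : ℝ} (hs : 0 < s) (hM : 0 < M)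
    (h₀ : ∀ k ∈ G, φ₀ (v k) ≤ M * w k) (h₁ : ∀ k ∈ G, φ₁ (v k) ≤ M * s * w k) (x : A) :
    lpENorm p (G.indicator fun k => X.kFun (v k) x / ENNReal.ofReal (w k)) ≤
      24 * ENNReal.ofReal M * K (X.interp φ₀ τ p) (X.interp φ₁ z p) s x := by
  let α : A → ℤ → ℝ≥0∞ := fun y => G.indicator fun k => X.kFun (v k) y / ENNReal.ofReal (w k)
  have hα₀ : ∀ y, lpENorm p (α y) ≤ 24 * ENNReal.ofReal M * X.interp φ₀ τ p y :=
    lpENorm_indicator_K_le hp₁ hφ₀ hτ h hM.le h₀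
  have hα₁ : ∀ y, lpENorm p (α y) ≤ 24 * ENNReal.ofReal (M * s) * X.interp φ₁ z p y :=
    lpENorm_indicator_K_le hp₁ hφ₁ hz h (by positivity) h₁
  have hα_add : ∀ y₀ y₁ k, α (y₀ + y₁) k ≤ α y₀ k + α y₁ k := fun y₀ y₁ k => by
    by_cases hk : k ∈ G
    · simp only [α, indicator_of_mem hk, ← ENNReal.add_div]
      gcongr
      exact kFun_add_le (h.pos k) y₀ y₁
    · simp [α, hk]
  have hM₀ : ENNReal.ofReal M ≠ 0 := (ENNReal.ofReal_pos.2 hM).ne'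
  refine le_mul_K (mul_ne_zero (by norm_num) hM₀)
    (ENNReal.mul_ne_top (by norm_num) ENNReal.ofReal_ne_top) ?_
  rintro x₀ x₁ rfl
  calc lpENorm p (α (x₀ + x₁)) ≤ lpENorm p (α x₀) + lpENorm p (α x₁) :=
        (lpENorm_mono (hα_add x₀ x₁)).trans (lpENorm_add_le hp₁ _ _)
    _ ≤ 24 * ENNReal.ofReal M * X.interp φ₀ τ p x₀ +
          24 * ENNReal.ofReal (M * s) * X.interp φ₁ z p x₁ := add_le_add (hα₀ x₀) (hα₁ x₁)
    _ = _ := by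
        rw [ENNReal.ofReal_mul hM.le]
        ring

theorem lpENorm_indicator_interpCoeff_compose_le (hp₁ : 1 ≤ p) (hφ : IsQuasiConcave φ)
    (hφ₀ : IsQuasiConcave φ₀) (hφ₁ : IsQuasiConcave φ₁) (hτ : IsDiscretizing φ₀ τ)
    (hz : IsDiscretizing φ₁ z) (ht : IsDiscretizing φ t)
    (ht' : IsDiscretizing (compose φ φ₀ φ₁) t') (m : ℤ) {G : Set ℤ}
    (hG : ∀ k ∈ G, φ₁ (t' k) / φ₀ (t' k) ∈ Icc (t m) (t (m + 1))) (x : A) :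
    lpENorm p (G.indicator
        (interpCoeff (compose φ φ₀ φ₁) t' (imageNorm X.incl₀) (imageNorm X.incl₁) x)) ≤
      48 * neighbourSum (interpCoeff φ t (X.interp φ₀ τ p) (X.interp φ₁ z p) x) m := by
  set β := interpCoeff φ t (X.interp φ₀ τ p) (X.interp φ₁ z p) x
  have ht₀ := ht.strongIncr.1
  obtain ⟨j, hj, hle⟩ := ht.exists_endpoint_le hφ m
  have htj := ht₀ j
  have hφj : 0 < φ (t j) := hφ.pos _ htj
  have h₀pos : ∀ k, 0 < φ₀ (t' k) := fun k => hφ₀.pos _ (ht'.strongIncr.1 k)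
  have h₀ : ∀ k ∈ G, φ₀ (t' k) ≤ 2 / φ (t j) * compose φ φ₀ φ₁ (t' k) := fun k hk => by
    rw [compose, div_mul_eq_mul_div, le_div_iff₀ hφj]
    nlinarith [h₀pos k, (hle _ (hG k hk)).1]
  have h₁ : ∀ k ∈ G, φ₁ (t' k) ≤ 2 / φ (t j) * t j * compose φ φ₀ φ₁ (t' k) := fun k hk => by
    have hr : 0 < φ₁ (t' k) / φ₀ (t' k) := (ht₀ m).trans_le (hG k hk).1
    have hquot := (hle _ (hG k hk)).2
    rw [← mul_div_assoc, div_le_div_iff₀ htj hr] at hquot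
    calc φ₁ (t' k) = φ (t j) * (φ₁ (t' k) / φ₀ (t' k)) * (φ₀ (t' k) / φ (t j)) := by
          have := h₀pos k
          field_simp
      _ ≤ 2 * φ (φ₁ (t' k) / φ₀ (t' k)) * t j * (φ₀ (t' k) / φ (t j)) :=
          mul_le_mul_of_nonneg_right hquot (div_pos (h₀pos k) hφj).le
      _ = _ := by rw [compose]; ring
  refine (X.lpENorm_indicator_kFun_le hp₁ hφ₀ hφ₁ hτ hz ht'.isScale htj (by positivity) h₀ h₁
    x).trans ?_
  calc 24 * ENNReal.ofReal (2 / φ (t j)) * K (X.interp φ₀ τ p) (X.interp φ₁ z p) (t j) x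
      = 48 * β j := by
        rw [ENNReal.ofReal_div_of_pos hφj, ENNReal.ofReal_ofNat]
        simp only [β, interpCoeff, div_eq_mul_inv]
        ring
    _ ≤ 48 * neighbourSum β m := by
        gcongr
        rcases hj with rfl | rfl
        exacts [self_le_neighbourSum β _, succ_le_neighbourSum β m]

theorem interp_compose_le (hp₁ : 1 ≤ p) (hφ : IsQuasiConcave φ)
    (hφ₀ : IsQuasiConcave φ₀) (hφ₁ : IsQuasiConcave φ₁) (hτ : IsDiscretizing φ₀ τ)
    (hz : IsDiscretizing φ₁ z) (ht : IsDiscretizing φ t)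
    (ht' : IsDiscretizing (compose φ φ₀ φ₁) t') (x : A) :
    X.interp (compose φ φ₀ φ₁) t' p x ≤
      144 * interpNorm φ t p (X.interp φ₀ τ p) (X.interp φ₁ z p) x := by
  have hp₀ : p ≠ 0 := (zero_lt_one.trans_le hp₁).ne'
  set α := interpCoeff (compose φ φ₀ φ₁) t' (imageNorm X.incl₀) (imageNorm X.incl₁) x
  set β := interpCoeff φ t (X.interp φ₀ τ p) (X.interp φ₁ z p) x
  choose n hn using fun k =>
    have ht'k := ht'.strongIncr.1 k
    ht.strongIncr.exists_mem_Ico (div_pos (hφ₁.pos _ ht'k) (hφ₀.pos _ ht'k))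
  have hblock : ∀ m, lpENorm p ((n ⁻¹' {m}).indicator α) ≤ 48 * neighbourSum β m := fun m =>
    X.lpENorm_indicator_interpCoeff_compose_le hp₁ hφ hφ₀ hφ₁ hτ hz ht ht' m
      (by rintro k rfl; exact Ico_subset_Icc_self (hn k)) x
  calc X.interp (compose φ φ₀ φ₁) t' p x = lpENorm p α := rfl
    _ = lpENorm p fun m => lpENorm p ((n ⁻¹' {m}).indicator α) := (lpENorm_fibers hp₀ n α).symm
    _ ≤ lpENorm p fun m => 48 * neighbourSum β m := lpENorm_mono hblock
    _ ≤ 48 * (3 * lpENorm p β) := by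
        rw [lpENorm_const_mul hp₀]
        gcongr
        exact lpENorm_neighbourSum_le hp₁ β
    _ = 144 * interpNorm φ t p (X.interp φ₀ τ p) (X.interp φ₁ z p) x := by
        change _ = 144 * lpENorm p β
        rw [← mul_assoc]
        norm_num

end BanachCouple

end RealInterpolation

theorem theorem3p7 {𝕜 : Type*} [RCLike 𝕜]
    (φ φ₀ φ₁ : ℝ → ℝ)
    (hφ : RealInterpolation.IsNondegQuasiConcave φ)
    (hφ₀ : RealInterpolation.IsNondegQuasiConcave φ₀)
    (hφ₁ : RealInterpolation.IsNondegQuasiConcave φ₁)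
    (p : ENNReal) (hp : 1 ≤ p)
    (τ z t t' : ℤ → ℝ)
    (hτ : RealInterpolation.IsDiscretizing φ₀ τ)
    (hz : RealInterpolation.IsDiscretizing φ₁ z)
    (ht : RealInterpolation.IsDiscretizing φ t)
    (ht' : RealInterpolation.IsDiscretizing (RealInterpolation.compose φ φ₀ φ₁) t') :
    ∃ C : NNReal, ∀ (X₀ X₁ A : Type*)
      [NormedAddCommGroup X₀] [NormedSpace 𝕜 X₀] [CompleteSpace X₀]
      [NormedAddCommGroup X₁] [NormedSpace 𝕜 X₁] [CompleteSpace X₁]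
      [AddCommGroup A] [Module 𝕜 A] [TopologicalSpace A] [IsTopologicalAddGroup A]
      [ContinuousSMul 𝕜 A] [T2Space A] (X : RealInterpolation.BanachCouple 𝕜 X₀ X₁ A),
      RealInterpolation.space
          (RealInterpolation.interpNorm φ t p (X.interp φ₀ τ p) (X.interp φ₁ z p)) =
        RealInterpolation.space (X.interp (RealInterpolation.compose φ φ₀ φ₁) t' p) ∧
      ∀ x : A,
        RealInterpolation.interpNorm φ t p (X.interp φ₀ τ p) (X.interp φ₁ z p) x ≤
          C * X.interp (RealInterpolation.compose φ φ₀ φ₁) t' p x ∧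
        X.interp (RealInterpolation.compose φ φ₀ φ₁) t' p x ≤
          C * RealInterpolation.interpNorm φ t p (X.interp φ₀ τ p) (X.interp φ₁ z p) x := by
  refine ⟨768, fun X₀ X₁ A => ?_⟩
  intro _ _ _ _ _ _ _ _ _ _ _ _ X
  have hle : ∀ x, RealInterpolation.interpNorm φ t p (X.interp φ₀ τ p) (X.interp φ₁ z p) x ≤
      (768 : NNReal) * X.interp (RealInterpolation.compose φ φ₀ φ₁) t' p x := fun x =>
    X.interpNorm_interp_le hp hφ hφ₀ hφ₁ hτ hz ht ht' x
  have hge : ∀ x, X.interp (RealInterpolation.compose φ φ₀ φ₁) t' p x ≤ (768 : NNReal) *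
      RealInterpolation.interpNorm φ t p (X.interp φ₀ τ p) (X.interp φ₁ z p) x := fun x =>
    (X.interp_compose_le hp hφ.isQuasiConcave hφ₀.isQuasiConcave hφ₁.isQuasiConcave hτ hz ht ht'
      x).trans (by gcongr; norm_num)
  exact ⟨Set.ext fun x => ⟨fun hx => (hge x).trans_lt (ENNReal.mul_lt_top ENNReal.coe_lt_top hx),
    fun hx => (hle x).trans_lt (ENNReal.mul_lt_top ENNReal.coe_lt_top hx)⟩,
    fun x => ⟨hle x, hge x⟩⟩
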